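/- A tile in $\mathbb{R}^2$ is a pair $\tau=(\mathrm{spt}(\tau),m)$ of a convex polygon $\mathrm{spt}(\tau)$ with nonempty interior and a mark $m$; put $\tau+v=(\mathrm{spt}(\tau)+v,m)$. A patch is a collection of tiles with pairwise disjoint interiors, its support is the union of the supports of its tiles, and a tiling is a patch with support $\mathbb{R}^2$. For a tiling $T$ and $R>0$ let $B_R[T]$ be the set of tiles of $T$ whose support meets the ball $B_R(0)$, and let $d(T,T')$ be the infimum of $1/\sqrt2$ and all $\epsilon>0$ for which there are $v,v'$ with $|v|,|v'|<\epsilon/2$ and $B_{1/\epsilon}[T'-v']=B_{1/\epsilon}[T-v]$. Let $\rho_1,\dots,\rho_k$ be translationally inequivalent tiles and $\lambda>1$. A self-similar substitution $\Phi$ assigns to each $\rho_i$ a patch $\Phi(\rho_i)$ consisting of translates of $\rho_1,\dots,\rho_k$ with support $\lambda\,\mathrm{spt}(\rho_i)$; it is extended to collections of translates of the $\rho_i$ by $\Phi(\{\rho_{i(j)}+v_j\}_j)=\bigcup_j(\Phi(\rho_{i(j)})+\lambda v_j)$. It is primitive if for all $i,j$ a translate of $\rho_i$ occurs in $\Phi^n(\rho_j)$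 for some $n$. The space $\Omega_\Phi$ is the set of all tilings each of whose finite subpatches is contained in a translate of $\Phi^m(\rho_i)$ for some $m\ge1$ and some $i$. It has finite local complexity (FLC) if for each $R$ there are, up to translation, only finitely many patches of diameter at most $R$ contained in tilings $T\in\Omega_\Phi$, and it is non-periodic if $T\in\Omega_\Phi$ and $T-v=T$ imply $v=0$. For $T,T'\in\Omega_\Phi$ write $T\sim_s T'$ if $d(\Phi^n(T),\Phi^n(T'))\to0$ as $n\to\infty$. A pair $(T,T')\in\Omega_\Phi\times\Omega_\Phi$ is a branch pair if $T\not\sim_sT'$ and there is an open half-space $H=\{x:\langle x,u\rangle>0\}$, $|u|=1$, with $T-x\sim_sT'-x$ for all $x\in H$. Its asymptotic sector $S(T,T')$ is the connected component of $\{v\in\mathbb{S}^1: T-tv\sim_sT'-tv\ \text{for all } t>0\}$ that contains $H\cap\mathbb{S}^1$ (if different choices of $H$ give different components, each of them counts as an asymptotic sector of the pair). **Theorem.** Let $\Phi$ be a primitive self-similar substitution in $\mathbb{R}^2$, with convex polygonal tiles, such that $\Omega_\Phi$ is non-periodic and has FLC. Then the collection of all asymptotic sectors $S(T,T')\subset\mathbb{S}^1$,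 where $(T,T')$ ranges over all branch pairs of $\Omega_\Phi$, is finite. -/

import Mathlib

open Set Filter Topology

/-- A tile in `ℝ^d`: a support together with a mark. Compactness and topological regularity of the
support are imposed on the prototiles of a substitution below; tiles of the tilings considered are
translates of prototiles. -/
@[ext]
structure Tile (d : ℕ) (M : Type*) where
  support : Set (EuclideanSpace ℝ (Fin d))
  mark : M

namespace Tile

variable {d : ℕ} {M : Type*}

/-- The translated tile `τ + v`. -/
def translate (v : EuclideanSpace ℝ (Fin d)) (τ : Tile d M) : Tile d M :=
  ⟨(fun x => x + v) '' τ.support, τ.mark⟩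

end Tile

namespace TilingSpace

variable {d : ℕ} {M : Type*}

/-- The translated collection of tiles `P + v`. -/
def translate (v : EuclideanSpace ℝ (Fin d)) (P : Set (Tile d M)) : Set (Tile d M) :=
  Tile.translate v '' P

/-- A patch: a collection of tiles with pairwise disjoint interiors. -/
def IsPatch (P : Set (Tile d M)) : Prop :=
  ∀ τ ∈ P, ∀ σ ∈ P, τ ≠ σ → Disjoint (interior τ.support) (interior σ.support)

/-- The support of a collection of tiles. -/
def spt (P : Set (Tile d M)) : Set (EuclideanSpace ℝ (Fin d)) :=
  ⋃ τ ∈ P, τ.support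

/-- A tiling of `ℝ^d`: a patch whose support is all of `ℝ^d`. -/
def IsTiling (T : Set (Tile d M)) : Prop :=
  IsPatch T ∧ spt T = Set.univ

/-- `B_R[T]`, for `R > 0`: the tiles of `T` that meet the ball of radius `R` about the origin. -/
def ballPatch (R : ℝ) (T : Set (Tile d M)) : Set (Tile d M) :=
  {τ ∈ T | (Metric.ball 0 R ∩ τ.support).Nonempty}

/-- The tiling metric: `T` and `T'` are within `ε` when translates of them by vectors of norm less
than `ε / 2` have the same tiles near the ball of radius `1 / ε`; distances are capped at
`1 / √2`, as is customary. -/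
noncomputable def tilingDist (T T' : Set (Tile d M)) : ℝ :=
  sInf (insert (1 / Real.sqrt 2)
    {ε : ℝ | 0 < ε ∧ ∃ v v' : EuclideanSpace ℝ (Fin d), ‖v‖ < ε / 2 ∧ ‖v'‖ < ε / 2 ∧
      ballPatch (1 / ε) (translate (-v') T') = ballPatch (1 / ε) (translate (-v) T)})

/-- Translationally finite local complexity of a collection `Ω` of tilings: for each `R` there are,
up to translation, only finitely many patches of diameter at most `R` in the members of `Ω`. The
diameter is taken in `[0, ∞]`, so that unbounded patches are not counted. -/
def HasFLC (Ω : Set (Set (Tile d M))) : Prop :=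
  ∀ R : ℝ, ∃ F : Set (Set (Tile d M)), F.Finite ∧
    ∀ T ∈ Ω, ∀ P ⊆ T, Metric.ediam (spt P) ≤ ENNReal.ofReal R →
      ∃ Q ∈ F, ∃ v : EuclideanSpace ℝ (Fin d), P = translate v Q

/-- The translation action on `Ω` is free. -/
def IsNonPeriodic (Ω : Set (Set (Tile d M))) : Prop :=
  ∀ T ∈ Ω, ∀ v : EuclideanSpace ℝ (Fin d), translate (-v) T = T → v = 0

end TilingSpace

open TilingSpace in
/-- A self-similar substitution in `ℝ^d`: finitely many translationally inequivalent prototiles,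
a scalar expansion factor greater than one, and for each prototile a patch of translates of
prototiles that covers exactly the inflated prototile. -/
structure SelfSimilarSubstitution (d : ℕ) (M : Type*) where
  /-- the number of prototiles -/
  numProto : ℕ
  /-- the prototiles -/
  proto : Fin numProto → Tile d M
  nonempty_proto : ∀ i, (proto i).support.Nonempty
  compact_proto : ∀ i, IsCompact (proto i).support
  /-- topological regularity -/
  regular_proto : ∀ i, closure (interior (proto i).support) = (proto i).support
  inequivalent : ∀ i j v, Tile.translate v (proto i) = proto j → i = j
  /-- the expansion factor -/
  scale : ℝ
  one_lt_scale : 1 < scale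
  /-- the patch substituted for a prototile -/
  rule : Fin numProto → Set (Tile d M)
  rule_isPatch : ∀ i, IsPatch (rule i)
  rule_translates : ∀ i, ∀ τ ∈ rule i, ∃ j v, τ = Tile.translate v (proto j)
  rule_spt : ∀ i, spt (rule i) = (fun x => scale • x) '' (proto i).support

namespace SelfSimilarSubstitution

open TilingSpace

variable {d : ℕ} {M : Type*} (Φ : SelfSimilarSubstitution d M)

/-- The extension of the substitution to collections of translates of prototiles: each tile
`ρ_i + v` is replaced by the patch `Φ(ρ_i) + λ v`. -/
def subst (P : Set (Tile d M)) : Set (Tile d M) :=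
  {σ | ∃ i v, Tile.translate v (Φ.proto i) ∈ P ∧ σ ∈ translate (Φ.scale • v) (Φ.rule i)}

/-- A patch is allowed if it is contained in a translate of some `Φ^m(ρ_i)` with `m ≥ 1`. -/
def Allowed (P : Set (Tile d M)) : Prop :=
  ∃ m : ℕ, 1 ≤ m ∧ ∃ i v, P ⊆ translate (-v) (Φ.subst^[m] {Φ.proto i})

/-- The substitution tiling space `Ω_Φ`. -/
def space : Set (Set (Tile d M)) :=
  {T | IsTiling T ∧ ∀ P ⊆ T, P.Finite → Φ.Allowed P}

/-- `Φ` is primitive: for all prototiles `ρ_i`, `ρ_j`, a translate of `ρ_i` occurs in some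
`Φ^n(ρ_j)`. -/
def IsPrimitive : Prop :=
  ∀ i j, ∃ n : ℕ, ∃ v, Tile.translate v (Φ.proto i) ∈ Φ.subst^[n] {Φ.proto j}

/-- All tiles are convex polygons (convex hulls of finite sets; nonempty interior is part of the
definition of a substitution). -/
def HasConvexPolygonalTiles : Prop :=
  ∀ i, ∃ s : Set (EuclideanSpace ℝ (Fin d)), s.Finite ∧ (Φ.proto i).support = convexHull ℝ s

/-- The stable manifold `W^s(T)`. -/
def stableManifold (T : Set (Tile d M)) : Set (Set (Tile d M)) :=
  {T' ∈ Φ.space | Tendsto (fun n : ℕ => tilingDist (Φ.subst^[n] T') (Φ.subst^[n] T)) atTop (𝓝 0)}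

/-- Stable equivalence `T ∼ₛ T'` of elements of `Ω_Φ`. -/
def StablyEquiv (T T' : Set (Tile d M)) : Prop :=
  T ∈ Φ.space ∧ T' ∈ Φ.space ∧ T ∈ Φ.stableManifold T'

/-- `T - x ∼ₛ T' - x` for all `x` in the open half-space `{x | ⟪x, u⟫ > 0}`. -/
def StablyEquivOnHalfSpace (T T' : Set (Tile d M)) (u : EuclideanSpace ℝ (Fin d)) : Prop :=
  ∀ x : EuclideanSpace ℝ (Fin d), 0 < inner ℝ x u →
    Φ.StablyEquiv (translate (-x) T) (translate (-x) T')

/-- `(T, T')` is a branch pair. -/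
def IsBranchPair (T T' : Set (Tile d M)) : Prop :=
  T ∈ Φ.space ∧ T' ∈ Φ.space ∧ ¬ Φ.StablyEquiv T T' ∧
    ∃ u : EuclideanSpace ℝ (Fin d), ‖u‖ = 1 ∧ Φ.StablyEquivOnHalfSpace T T' u

/-- The set of unit vectors `v` with `T - t v ∼ₛ T' - t v` for all `t > 0`. -/
def stableDirections (T T' : Set (Tile d M)) : Set (EuclideanSpace ℝ (Fin d)) :=
  {v | v ∈ Metric.sphere 0 1 ∧
    ∀ t : ℝ, 0 < t → Φ.StablyEquiv (translate (-(t • v)) T) (translate (-(t • v)) T')}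

/-- `S` is an asymptotic sector of `(T, T')`: the connected component of the set of stable
directions that contains an open hemisphere `{v | ⟪v, u⟫ > 0}` as in the definition of a branch
pair; as the hemisphere is connected, this is the component of `u`. -/
def IsAsymptoticSector (T T' : Set (Tile d M)) (S : Set (EuclideanSpace ℝ (Fin d))) : Prop :=
  ∃ u : EuclideanSpace ℝ (Fin d), ‖u‖ = 1 ∧ Φ.StablyEquivOnHalfSpace T T' u ∧
    S = connectedComponentIn (Φ.stableDirections T T') u

end SelfSimilarSubstitution

namespace Tile

/-! ### Translation of tiles and patches. -/

variable {d : ℕ} {M : Type*}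

theorem mem_support_translate {v x : EuclideanSpace ℝ (Fin d)} {τ : Tile d M} :
    x ∈ (translate v τ).support ↔ x - v ∈ τ.support := by
  constructor
  · rintro ⟨y, hy, rfl⟩
    simpa using hy
  · intro h
    exact ⟨x - v, h, by simp⟩

@[simp]
theorem translate_zero (τ : Tile d M) : translate 0 τ = τ := by
  ext x
  · rw [mem_support_translate, sub_zero]
  · rfl

@[simp]
theorem translate_translate (v w : EuclideanSpace ℝ (Fin d)) (τ : Tile d M) :
    translate v (translate w τ) = translate (w + v) τ := by
  ext x
  · simp only [mem_support_translate, sub_sub, add_comm]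
  · rfl

theorem mem_interior_translate {v x : EuclideanSpace ℝ (Fin d)} {τ : Tile d M} :
    x ∈ interior (translate v τ).support ↔ x - v ∈ interior τ.support := by
  have h : (translate v τ).support = (Homeomorph.addRight (-v)) ⁻¹' τ.support := by
    ext y
    simp [mem_support_translate, sub_eq_add_neg]
  rw [h, ← Homeomorph.preimage_interior]
  simp [sub_eq_add_neg]

/-- The functional `⟪·, v⟫` attains its maximum on the compact support, and a shift by v raises it
by `‖v‖ ^ 2`. -/
theorem eq_zero_of_translate_eq_self {v : EuclideanSpace ℝ (Fin d)} {τ : Tile d M}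
    (hc : IsCompact τ.support) (hne : τ.support.Nonempty) (h : translate v τ = τ) : v = 0 := by
  obtain ⟨x, hx, hmax⟩ := hc.exists_isMaxOn hne
    (f := fun y => inner ℝ y v) (by fun_prop)
  have h1 : x + v ∈ τ.support := by
    rw [← h, mem_support_translate]
    simpa using hx
  have h2 := hmax h1
  simp only [mem_ofPred_eq, inner_add_left, real_inner_self_eq_norm_sq] at h2
  have : ‖v‖ = 0 := by nlinarith [norm_nonneg v]
  simpa using this

end Tile

namespace TilingSpace

variable {d : ℕ} {M : Type*}

theorem mem_translate {v : EuclideanSpace ℝ (Fin d)} {P : Set (Tile d M)} {τ : Tile d M} :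
    τ ∈ translate v P ↔ Tile.translate (-v) τ ∈ P := by
  constructor
  · rintro ⟨σ, hσ, rfl⟩
    simpa using hσ
  · intro h
    exact ⟨_, h, by simp⟩

theorem translate_mem_translate {v : EuclideanSpace ℝ (Fin d)} {P : Set (Tile d M)}
    {τ : Tile d M} (h : τ ∈ P) : Tile.translate v τ ∈ translate v P :=
  mem_image_of_mem _ h

@[simp]
theorem translate_zero (P : Set (Tile d M)) : translate 0 P = P := by
  ext τ
  simp [mem_translate]

@[simp]
theorem translate_translate (v w : EuclideanSpace ℝ (Fin d)) (P : Set (Tile d M)) :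
    translate v (translate w P) = translate (w + v) P := by
  ext τ
  simp [mem_translate, add_comm]

theorem translate_mono {v : EuclideanSpace ℝ (Fin d)} {P Q : Set (Tile d M)} (h : P ⊆ Q) :
    translate v P ⊆ translate v Q :=
  image_mono h

theorem translate_subset_iff {v : EuclideanSpace ℝ (Fin d)} {P Q : Set (Tile d M)} :
    translate v P ⊆ Q ↔ P ⊆ translate (-v) Q := by
  constructor
  · intro h
    simpa using translate_mono (v := -v) h
  · intro h
    simpa using translate_mono (v := v) h

theorem translate_singleton (v : EuclideanSpace ℝ (Fin d)) (τ : Tile d M) :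
    translate v {τ} = {Tile.translate v τ} :=
  image_singleton

theorem mem_spt {P : Set (Tile d M)} {x : EuclideanSpace ℝ (Fin d)} :
    x ∈ spt P ↔ ∃ τ ∈ P, x ∈ τ.support := by
  simp [spt]

theorem spt_singleton (τ : Tile d M) : spt {τ} = τ.support := by
  simp [spt]

theorem mem_spt_translate {v x : EuclideanSpace ℝ (Fin d)} {P : Set (Tile d M)} :
    x ∈ spt (translate v P) ↔ x - v ∈ spt P := by
  simp only [mem_spt, translate, exists_mem_image, Tile.mem_support_translate]

theorem IsPatch.mono {P Q : Set (Tile d M)} (hQ : IsPatch Q) (h : P ⊆ Q) : IsPatch P :=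
  fun τ hτ σ hσ hne => hQ τ (h hτ) σ (h hσ) hne

theorem IsPatch.eq_of_mem_interior {P : Set (Tile d M)} (hP : IsPatch P) {τ σ : Tile d M}
    (hτ : τ ∈ P) (hσ : σ ∈ P) {x : EuclideanSpace ℝ (Fin d)}
    (h1 : x ∈ interior τ.support) (h2 : x ∈ interior σ.support) : τ = σ := by
  by_contra hne
  exact disjoint_left.1 (hP τ hτ σ hσ hne) h1 h2

theorem IsPatch.translate {P : Set (Tile d M)} (hP : IsPatch P)
    (v : EuclideanSpace ℝ (Fin d)) : IsPatch (translate v P) := by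
  rintro _ ⟨τ, hτ, rfl⟩ _ ⟨σ, hσ, rfl⟩ hne
  rw [disjoint_left]
  intro x hx hx'
  rw [Tile.mem_interior_translate] at hx hx'
  exact hne (by rw [hP.eq_of_mem_interior hτ hσ hx hx'])

theorem IsTiling.translate {T : Set (Tile d M)} (hT : IsTiling T)
    (v : EuclideanSpace ℝ (Fin d)) : IsTiling (translate v T) := by
  refine ⟨hT.1.translate v, ?_⟩
  ext x
  simp [mem_spt_translate, hT.2]

theorem IsTiling.exists_mem {T : Set (Tile d M)} (hT : IsTiling T)
    (x : EuclideanSpace ℝ (Fin d)) : ∃ τ ∈ T, x ∈ τ.support := by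
  rw [← mem_spt, hT.2]
  trivial

end TilingSpace

/-! ### The substitution acting on collections of tiles. -/

namespace SelfSimilarSubstitution

open TilingSpace

variable {d : ℕ} {M : Type*} (Φ : SelfSimilarSubstitution d M)

theorem scale_pos : 0 < Φ.scale := zero_lt_one.trans Φ.one_lt_scale

theorem scale_ne_zero : Φ.scale ≠ 0 := Φ.scale_pos.ne'

theorem scale_pow_pos (n : ℕ) : 0 < Φ.scale ^ n := pow_pos Φ.scale_pos n

theorem scale_pow_ne_zero (n : ℕ) : Φ.scale ^ n ≠ 0 := (Φ.scale_pow_pos n).ne'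

/-- The tile `τ` is a translate of a prototile. -/
def IsProtoTile (τ : Tile d M) : Prop :=
  ∃ i v, τ = Tile.translate v (Φ.proto i)

/-- All members of `P` are translates of prototiles. -/
def HasProtoTiles (P : Set (Tile d M)) : Prop :=
  ∀ τ ∈ P, Φ.IsProtoTile τ

variable {Φ}

theorem IsProtoTile.translate {τ : Tile d M} (h : Φ.IsProtoTile τ)
    (v : EuclideanSpace ℝ (Fin d)) : Φ.IsProtoTile (Tile.translate v τ) := by
  obtain ⟨i, w, rfl⟩ := h
  exact ⟨i, w + v, by simp⟩

theorem HasProtoTiles.translate {P : Set (Tile d M)} (h : Φ.HasProtoTiles P)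
    (v : EuclideanSpace ℝ (Fin d)) : Φ.HasProtoTiles (translate v P) := by
  rintro _ ⟨τ, hτ, rfl⟩
  exact (h τ hτ).translate v

theorem HasProtoTiles.mono {P Q : Set (Tile d M)} (h : Φ.HasProtoTiles Q) (hPQ : P ⊆ Q) :
    Φ.HasProtoTiles P := fun τ hτ => h τ (hPQ hτ)

theorem isProtoTile_proto (i : Fin Φ.numProto) : Φ.IsProtoTile (Φ.proto i) := ⟨i, 0, by simp⟩

theorem hasProtoTiles_singleton {τ : Tile d M} (h : Φ.IsProtoTile τ) :
    Φ.HasProtoTiles {τ} := by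
  rintro _ rfl
  exact h

/-- Type and position of a tile are unique, so `subst` replaces each tile by exactly one patch. -/
theorem translate_proto_inj {i j : Fin Φ.numProto} {v w : EuclideanSpace ℝ (Fin d)}
    (h : Tile.translate v (Φ.proto i) = Tile.translate w (Φ.proto j)) : i = j ∧ v = w := by
  have h' : Tile.translate (v - w) (Φ.proto i) = Φ.proto j := by
    have := congrArg (Tile.translate (-w)) h
    simpa [sub_eq_add_neg] using this
  obtain rfl := Φ.inequivalent _ _ _ h'
  refine ⟨rfl, ?_⟩
  exact sub_eq_zero.1 (Tile.eq_zero_of_translate_eq_self (Φ.compact_proto i)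
    (Φ.nonempty_proto i) h')

theorem IsProtoTile.isCompact {τ : Tile d M} (h : Φ.IsProtoTile τ) : IsCompact τ.support := by
  obtain ⟨i, v, rfl⟩ := h
  exact (Φ.compact_proto i).image (by fun_prop)

theorem IsProtoTile.nonempty {τ : Tile d M} (h : Φ.IsProtoTile τ) : τ.support.Nonempty := by
  obtain ⟨i, v, rfl⟩ := h
  exact (Φ.nonempty_proto i).image _

theorem IsProtoTile.subset_closure_interior {τ : Tile d M} (h : Φ.IsProtoTile τ) :
    τ.support ⊆ closure (interior τ.support) := by
  obtain ⟨i, v, rfl⟩ := h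
  have h2 : interior (Tile.translate v (Φ.proto i)).support =
      (fun x => x + v) '' interior (Φ.proto i).support := by
    ext x
    rw [Tile.mem_interior_translate]
    constructor
    · intro hx
      exact ⟨_, hx, by simp⟩
    · rintro ⟨y, hy, rfl⟩
      simpa using hy
  rw [h2]
  have h3 : (Tile.translate v (Φ.proto i)).support =
      (fun x => x + v) '' closure (interior (Φ.proto i).support) := by
    rw [Φ.regular_proto]
    rfl
  rw [h3]
  exact image_closure_subset_closure_image (by fun_prop)

theorem IsProtoTile.eq_zero_of_translate_eq {τ : Tile d M} (h : Φ.IsProtoTile τ)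
    {v : EuclideanSpace ℝ (Fin d)} (hv : Tile.translate v τ = τ) : v = 0 :=
  Tile.eq_zero_of_translate_eq_self h.isCompact h.nonempty hv

theorem mem_subst_iff {P : Set (Tile d M)} {σ : Tile d M} :
    σ ∈ Φ.subst P ↔ ∃ i v, Tile.translate v (Φ.proto i) ∈ P ∧
      Tile.translate (-(Φ.scale • v)) σ ∈ Φ.rule i := by
  simp only [subst, mem_ofPred_eq, mem_translate]

theorem subst_mono {P Q : Set (Tile d M)} (h : P ⊆ Q) : Φ.subst P ⊆ Φ.subst Q := by
  rintro σ ⟨i, v, h1, h2⟩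
  exact ⟨i, v, h h1, h2⟩

theorem subst_translate (v : EuclideanSpace ℝ (Fin d)) (P : Set (Tile d M)) :
    Φ.subst (translate v P) = translate (Φ.scale • v) (Φ.subst P) := by
  ext σ
  simp only [mem_subst_iff, mem_translate, Tile.translate_translate]
  constructor
  · rintro ⟨i, w, h1, h2⟩
    refine ⟨i, w + -v, h1, ?_⟩
    convert h2 using 2
    module
  · rintro ⟨i, w, h1, h2⟩
    refine ⟨i, w + v, by simpa using h1, ?_⟩
    convert h2 using 2
    module

theorem exists_mem_of_mem_subst {P : Set (Tile d M)} {σ : Tile d M} (h : σ ∈ Φ.subst P) :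
    ∃ τ ∈ P, σ ∈ Φ.subst {τ} := by
  obtain ⟨i, v, h1, h2⟩ := h
  exact ⟨_, h1, i, v, rfl, h2⟩

theorem hasProtoTiles_subst (P : Set (Tile d M)) : Φ.HasProtoTiles (Φ.subst P) := by
  rintro σ ⟨i, v, -, τ, hτ, rfl⟩
  obtain ⟨j, w, rfl⟩ := Φ.rule_translates i τ hτ
  exact ⟨j, w + Φ.scale • v, by simp⟩

theorem subst_singleton (i : Fin Φ.numProto) (v : EuclideanSpace ℝ (Fin d)) :
    Φ.subst {Tile.translate v (Φ.proto i)} = translate (Φ.scale • v) (Φ.rule i) := by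
  ext σ
  constructor
  · rintro ⟨j, w, h1, h2⟩
    obtain ⟨rfl, rfl⟩ := translate_proto_inj (mem_singleton_iff.1 h1)
    exact h2
  · intro h
    exact ⟨i, v, rfl, h⟩

theorem mem_spt_subst {P : Set (Tile d M)} (hP : Φ.HasProtoTiles P)
    {x : EuclideanSpace ℝ (Fin d)} : x ∈ spt (Φ.subst P) ↔ Φ.scale⁻¹ • x ∈ spt P := by
  have key : ∀ i v, x ∈ spt (Φ.subst {Tile.translate v (Φ.proto i)}) ↔
      Φ.scale⁻¹ • x ∈ (Tile.translate v (Φ.proto i)).support := by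
    intro i v
    rw [subst_singleton, mem_spt_translate, Φ.rule_spt, Tile.mem_support_translate]
    constructor
    · rintro ⟨y, hy, hxy⟩
      convert hy using 1
      have : x = Φ.scale • y + Φ.scale • v := by
        rw [← sub_eq_iff_eq_add]
        exact hxy.symm
      rw [this, smul_add, inv_smul_smul₀ Φ.scale_ne_zero, inv_smul_smul₀ Φ.scale_ne_zero]
      simp
    · intro h
      refine ⟨_, h, ?_⟩
      simp only [smul_sub, smul_inv_smul₀ Φ.scale_ne_zero]
  constructor
  · intro h
    obtain ⟨σ, hσ, hx⟩ := mem_spt.1 h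
    obtain ⟨τ, hτ, hστ⟩ := exists_mem_of_mem_subst hσ
    obtain ⟨i, v, rfl⟩ := hP τ hτ
    exact mem_spt.2 ⟨_, hτ, (key i v).1 (mem_spt.2 ⟨σ, hστ, hx⟩)⟩
  · intro h
    obtain ⟨τ, hτ, hx⟩ := mem_spt.1 h
    obtain ⟨i, v, rfl⟩ := hP τ hτ
    obtain ⟨σ, hσ, hx'⟩ := mem_spt.1 ((key i v).2 hx)
    exact mem_spt.2 ⟨σ, subst_mono (singleton_subset_iff.2 hτ) hσ, hx'⟩

theorem smul_mem_interior_of_forall {s t : Set (EuclideanSpace ℝ (Fin d))} {c : ℝ} (hc : c ≠ 0)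
    (h : ∀ y ∈ s, c • y ∈ t) {x : EuclideanSpace ℝ (Fin d)} (hx : x ∈ interior s) :
    c • x ∈ interior t := by
  rw [mem_interior]
  refine ⟨(fun y => c • y) '' interior s, ?_, isOpenMap_smul₀ hc _ isOpen_interior,
    mem_image_of_mem _ hx⟩
  rintro _ ⟨y, hy, rfl⟩
  exact h y (interior_subset hy)

/-- Tiles with different parents have interiors inside disjoint inflated interiors; tiles with the
same parent are separated by the rule. -/
theorem isPatch_subst {P : Set (Tile d M)} (hP : IsPatch P) (hP' : Φ.HasProtoTiles P) :
    IsPatch (Φ.subst P) := by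
  intro σ₁ h₁ σ₂ h₂ hne
  obtain ⟨τ₁, hτ₁, hσ₁⟩ := exists_mem_of_mem_subst h₁
  obtain ⟨τ₂, hτ₂, hσ₂⟩ := exists_mem_of_mem_subst h₂
  by_cases h : τ₁ = τ₂
  · subst h
    obtain ⟨i, v, rfl⟩ := hP' _ hτ₁
    rw [subst_singleton] at hσ₁ hσ₂
    exact ((Φ.rule_isPatch i).translate _) _ hσ₁ _ hσ₂ hne
  · have key : ∀ τ ∈ P, ∀ σ ∈ Φ.subst {τ}, ∀ x ∈ interior σ.support,
        Φ.scale⁻¹ • x ∈ interior τ.support := by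
      intro τ hτ σ hσ x hx
      refine smul_mem_interior_of_forall (inv_ne_zero Φ.scale_ne_zero) ?_ hx
      intro y hy
      have := (mem_spt_subst (hasProtoTiles_singleton (hP' τ hτ))).1 (mem_spt.2 ⟨σ, hσ, hy⟩)
      rwa [spt_singleton] at this
    rw [disjoint_left]
    intro x hx hx'
    exact h (hP.eq_of_mem_interior hτ₁ hτ₂ (key _ hτ₁ _ hσ₁ x hx) (key _ hτ₂ _ hσ₂ x hx'))

/-! Iterates of the substitution. -/

theorem iterate_subst_mono {P Q : Set (Tile d M)} (h : P ⊆ Q) (n : ℕ) :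
    Φ.subst^[n] P ⊆ Φ.subst^[n] Q := by
  induction n with
  | zero => exact h
  | succ n ih =>
    rw [Function.iterate_succ_apply', Function.iterate_succ_apply']
    exact subst_mono ih

theorem iterate_subst_translate (n : ℕ) (v : EuclideanSpace ℝ (Fin d)) (P : Set (Tile d M)) :
    Φ.subst^[n] (translate v P) = translate (Φ.scale ^ n • v) (Φ.subst^[n] P) := by
  induction n with
  | zero => simp
  | succ n ih =>
    rw [Function.iterate_succ_apply', ih, subst_translate, Function.iterate_succ_apply',
      smul_smul, pow_succ']

theorem exists_mem_of_mem_iterate_subst {P : Set (Tile d M)} {σ : Tile d M} {n : ℕ}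
    (h : σ ∈ Φ.subst^[n] P) : ∃ τ ∈ P, σ ∈ Φ.subst^[n] {τ} := by
  induction n generalizing σ with
  | zero => exact ⟨σ, h, rfl⟩
  | succ n ih =>
    rw [Function.iterate_succ_apply'] at h
    obtain ⟨ρ, hρ, hσ⟩ := exists_mem_of_mem_subst h
    obtain ⟨τ, hτ, hρτ⟩ := ih hρ
    refine ⟨τ, hτ, ?_⟩
    rw [Function.iterate_succ_apply']
    exact subst_mono (singleton_subset_iff.2 hρτ) hσ

theorem HasProtoTiles.iterate_subst {P : Set (Tile d M)} (hP : Φ.HasProtoTiles P) (n : ℕ) :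
    Φ.HasProtoTiles (Φ.subst^[n] P) := by
  cases n with
  | zero => exact hP
  | succ n =>
    rw [Function.iterate_succ_apply']
    exact hasProtoTiles_subst _

theorem mem_spt_iterate_subst {P : Set (Tile d M)} (hP : Φ.HasProtoTiles P) {n : ℕ}
    {x : EuclideanSpace ℝ (Fin d)} :
    x ∈ spt (Φ.subst^[n] P) ↔ (Φ.scale ^ n)⁻¹ • x ∈ spt P := by
  induction n generalizing x with
  | zero => simp
  | succ n ih =>
    rw [Function.iterate_succ_apply', mem_spt_subst (hP.iterate_subst n), ih, smul_smul,
      pow_succ, mul_inv]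

theorem smul_mem_spt_iterate_subst {P : Set (Tile d M)} (hP : Φ.HasProtoTiles P) {n : ℕ}
    {x : EuclideanSpace ℝ (Fin d)} :
    Φ.scale ^ n • x ∈ spt (Φ.subst^[n] P) ↔ x ∈ spt P := by
  rw [mem_spt_iterate_subst hP, inv_smul_smul₀ (Φ.scale_pow_ne_zero n)]

theorem inv_smul_mem_support_of_mem_iterate {τ σ : Tile d M} (hτ : Φ.IsProtoTile τ) {n : ℕ}
    (hσ : σ ∈ Φ.subst^[n] {τ}) {x : EuclideanSpace ℝ (Fin d)} (hx : x ∈ σ.support) :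
    (Φ.scale ^ n)⁻¹ • x ∈ τ.support := by
  have := (mem_spt_iterate_subst (hasProtoTiles_singleton hτ)).1 (mem_spt.2 ⟨σ, hσ, hx⟩)
  rwa [spt_singleton] at this

theorem isPatch_iterate_subst {P : Set (Tile d M)} (hP : IsPatch P) (hP' : Φ.HasProtoTiles P)
    (n : ℕ) : IsPatch (Φ.subst^[n] P) := by
  induction n with
  | zero => exact hP
  | succ n ih =>
    rw [Function.iterate_succ_apply']
    exact isPatch_subst ih (hP'.iterate_subst n)

/-! The tiling space. -/

theorem hasProtoTiles_of_mem_space {T : Set (Tile d M)} (hT : T ∈ Φ.space) :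
    Φ.HasProtoTiles T := by
  intro τ hτ
  obtain ⟨m, -, i, v, h⟩ := hT.2 {τ} (singleton_subset_iff.2 hτ) (finite_singleton τ)
  exact (((hasProtoTiles_singleton (isProtoTile_proto i)).iterate_subst m).translate _) τ
    (h rfl)

theorem translate_mem_space {T : Set (Tile d M)} (hT : T ∈ Φ.space)
    (v : EuclideanSpace ℝ (Fin d)) : translate v T ∈ Φ.space := by
  refine ⟨hT.1.translate v, fun P hP hfin => ?_⟩
  obtain ⟨m, hm, i, w, h⟩ := hT.2 (translate (-v) P)
    (by rw [translate_subset_iff]; simpa using hP) (hfin.image _)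
  refine ⟨m, hm, i, w - v, ?_⟩
  rw [translate_subset_iff, translate_translate] at h
  convert h using 2
  abel

theorem exists_finite_subset_of_subset_iterate {P Q : Set (Tile d M)} {n : ℕ} (hQ : Q.Finite)
    (h : Q ⊆ Φ.subst^[n] P) : ∃ F ⊆ P, F.Finite ∧ Q ⊆ Φ.subst^[n] F := by
  choose! f hf hf' using fun σ (hσ : σ ∈ Q) => exists_mem_of_mem_iterate_subst (h hσ)
  refine ⟨f '' Q, image_subset_iff.2 hf, hQ.image f, fun σ hσ => ?_⟩
  exact iterate_subst_mono (singleton_subset_iff.2 (mem_image_of_mem f hσ)) n (hf' σ hσ)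

theorem iterate_subst_mem_space {T : Set (Tile d M)} (hT : T ∈ Φ.space) (n : ℕ) :
    Φ.subst^[n] T ∈ Φ.space := by
  have hp := hasProtoTiles_of_mem_space hT
  refine ⟨⟨isPatch_iterate_subst hT.1.1 hp n, ?_⟩, fun P hP hfin => ?_⟩
  · ext x
    simp [mem_spt_iterate_subst hp, hT.1.2]
  · obtain ⟨F, hFT, hF, hPF⟩ := exists_finite_subset_of_subset_iterate hfin hP
    obtain ⟨m, hm, i, w, h⟩ := hT.2 F hFT hF
    refine ⟨n + m, by omega, i, Φ.scale ^ n • w, hPF.trans ?_⟩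
    have := iterate_subst_mono (Φ := Φ) h n
    rw [iterate_subst_translate, ← Function.iterate_add_apply] at this
    simpa using this

end SelfSimilarSubstitution

/-! ### Tiles at a point. -/

namespace TilingSpace

variable {d : ℕ} {M : Type*}

/-- The tiles of `T` that contain the point `x`. -/
def star (T : Set (Tile d M)) (x : EuclideanSpace ℝ (Fin d)) : Set (Tile d M) :=
  {τ ∈ T | x ∈ τ.support}

theorem mem_star {T : Set (Tile d M)} {x : EuclideanSpace ℝ (Fin d)} {τ : Tile d M} :
    τ ∈ star T x ↔ τ ∈ T ∧ x ∈ τ.support := Iff.rfl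

theorem star_subset (T : Set (Tile d M)) (x : EuclideanSpace ℝ (Fin d)) : star T x ⊆ T :=
  fun _ h => h.1

theorem star_translate (v x : EuclideanSpace ℝ (Fin d)) (T : Set (Tile d M)) :
    star (translate v T) x = translate v (star T (x - v)) := by
  ext τ
  simp [mem_star, mem_translate, Tile.mem_support_translate]

theorem translate_injective (v : EuclideanSpace ℝ (Fin d)) :
    Function.Injective (translate v : Set (Tile d M) → Set (Tile d M)) := by
  intro P Q h
  simpa using congrArg (translate (-v)) h

theorem IsTiling.star_nonempty {T : Set (Tile d M)} (hT : IsTiling T)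
    (x : EuclideanSpace ℝ (Fin d)) : (star T x).Nonempty :=
  hT.exists_mem x

theorem mem_ballPatch {R : ℝ} {T : Set (Tile d M)} {τ : Tile d M} :
    τ ∈ ballPatch R T ↔ τ ∈ T ∧ ∃ x, ‖x‖ < R ∧ x ∈ τ.support := by
  simp [ballPatch, Set.Nonempty]

theorem star_eq_of_ballPatch_eq {R : ℝ} {T T' : Set (Tile d M)}
    (h : ballPatch R T = ballPatch R T') {x : EuclideanSpace ℝ (Fin d)} (hx : ‖x‖ < R) :
    star T x = star T' x := by
  have key : ∀ {T T' : Set (Tile d M)}, ballPatch R T = ballPatch R T' →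
      star T x ⊆ star T' x := by
    intro T T' h τ hτ
    have h1 : τ ∈ ballPatch R T := mem_ballPatch.2 ⟨hτ.1, x, hx, hτ.2⟩
    rw [h] at h1
    exact ⟨h1.1, hτ.2⟩
  exact (key h).antisymm (key h.symm)

theorem ballPatch_eq_of_star_eq {R : ℝ} {T T' : Set (Tile d M)}
    (h : ∀ x, ‖x‖ < R → star T x = star T' x) : ballPatch R T = ballPatch R T' := by
  ext τ
  rw [mem_ballPatch, mem_ballPatch]
  constructor
  · rintro ⟨h1, x, hx, hxτ⟩
    have h2 : τ ∈ star T x := ⟨h1, hxτ⟩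
    rw [h x hx] at h2
    exact ⟨h2.1, x, hx, hxτ⟩
  · rintro ⟨h1, x, hx, hxτ⟩
    have h2 : τ ∈ star T' x := ⟨h1, hxτ⟩
    rw [← h x hx] at h2
    exact ⟨h2.1, x, hx, hxτ⟩

end TilingSpace

/-! ### Local finiteness and its consequences for stars. -/

namespace SelfSimilarSubstitution

open TilingSpace

variable {d : ℕ} {M : Type*} (Φ : SelfSimilarSubstitution d M)

/-- A common inradius of the prototiles. -/
theorem exists_inradius : ∃ η : ℝ, 0 < η ∧ ∀ τ, Φ.IsProtoTile τ →
    ∃ c, Metric.ball c η ⊆ interior τ.support := by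
  have h1 : ∀ i, ∃ c, ∃ r > 0, Metric.ball c r ⊆ interior (Φ.proto i).support := by
    intro i
    have : (interior (Φ.proto i).support).Nonempty := by
      rw [← closure_nonempty_iff, Φ.regular_proto]
      exact Φ.nonempty_proto i
    obtain ⟨c, hc⟩ := this
    obtain ⟨r, hr, h⟩ := Metric.isOpen_iff.1 isOpen_interior c hc
    exact ⟨c, r, hr, h⟩
  choose c r hr hc using h1
  have h2 : ∀ᶠ η in 𝓝[>] (0 : ℝ), ∀ i, η ≤ r i :=
    eventually_all.2 fun i => eventually_nhdsWithin_of_eventually_nhds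
      (eventually_le_nhds (hr i))
  obtain ⟨η, h, hη⟩ := (h2.and self_mem_nhdsWithin).exists
  refine ⟨η, hη, ?_⟩
  rintro _ ⟨i, v, rfl⟩
  refine ⟨c i + v, fun x hx => ?_⟩
  rw [Tile.mem_interior_translate]
  refine hc i (Metric.ball_subset_ball (h i) ?_)
  rw [Metric.mem_ball, dist_eq_norm] at hx ⊢
  rwa [sub_sub, add_comm v]

/-- A common bound for the diameters of the prototiles. -/
theorem exists_diam : ∃ D : ℝ, 0 < D ∧ ∀ τ, Φ.IsProtoTile τ →
    ∀ x ∈ τ.support, ∀ y ∈ τ.support, ‖x - y‖ ≤ D := by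
  have h2 : ∀ᶠ D in atTop, ∀ i, Metric.diam (Φ.proto i).support ≤ D :=
    eventually_all.2 fun i => eventually_ge_atTop _
  obtain ⟨D, h, hD⟩ := (h2.and (eventually_gt_atTop (0 : ℝ))).exists
  refine ⟨D, hD, ?_⟩
  rintro _ ⟨i, v, rfl⟩ x hx y hy
  rw [Tile.mem_support_translate] at hx hy
  have := (Metric.dist_le_diam_of_mem (Φ.compact_proto i).isBounded hx hy).trans (h i)
  rwa [dist_eq_norm, sub_sub_sub_cancel_right] at this

variable {Φ}

/-- A packing argument: the centres of inscribed balls of common radius η are η-separated in a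
bounded region. -/
theorem finite_setOf_mem_inter_ball {P : Set (Tile d M)} (hP : IsPatch P)
    (hP' : Φ.HasProtoTiles P) (R : ℝ) :
    {τ ∈ P | ∃ x, ‖x‖ < R ∧ x ∈ τ.support}.Finite := by
  obtain ⟨η, hη, hball⟩ := Φ.exists_inradius
  obtain ⟨D, hD, hdiam⟩ := Φ.exists_diam
  choose! c hc using hball
  have hcmem : ∀ τ, Φ.IsProtoTile τ → c τ ∈ interior τ.support :=
    fun τ hτ => hc τ hτ (Metric.mem_ball_self hη)
  obtain ⟨t, -, htfin, hcov⟩ := (isCompact_closedBall (0 : EuclideanSpace ℝ (Fin d))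
    (R + D)).finite_cover_balls (half_pos hη)
  have h1 : ∀ τ ∈ {τ ∈ P | ∃ x, ‖x‖ < R ∧ x ∈ τ.support},
      ∃ y ∈ t, c τ ∈ Metric.ball y (η / 2) := by
    rintro τ ⟨hτ, x, hxR, hx⟩
    have h2 : c τ ∈ Metric.closedBall (0 : EuclideanSpace ℝ (Fin d)) (R + D) := by
      rw [mem_closedBall_zero_iff]
      have h3 := hdiam τ (hP' τ hτ) (c τ) (interior_subset (hcmem τ (hP' τ hτ))) x hx
      have h4 := norm_add_le x (c τ - x)
      rw [add_sub_cancel] at h4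
      linarith
    simpa using hcov h2
  choose! f hft hf using h1
  refine Set.Finite.of_injOn (f := f) hft ?_ htfin
  intro τ hτ σ hσ hfe
  have h2 : c σ ∈ Metric.ball (c τ) η := by
    have e1 := hf τ hτ
    have e2 := hf σ hσ
    rw [← hfe] at e2
    rw [Metric.mem_ball] at *
    have := dist_triangle_right (c σ) (c τ) (f τ)
    linarith
  exact hP.eq_of_mem_interior hτ.1 hσ.1 (hc τ (hP' τ hτ.1) h2) (hcmem σ (hP' σ hσ.1))

variable (Φ) in
/-- Two tiles of a patch that differ by a small translation are equal. -/
theorem exists_separation : ∃ η : ℝ, 0 < η ∧ ∀ P : Set (Tile d M), IsPatch P →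
    Φ.HasProtoTiles P → ∀ τ ∈ P, ∀ w, ‖w‖ < η → Tile.translate w τ ∈ P → w = 0 := by
  obtain ⟨η, hη, hball⟩ := Φ.exists_inradius
  refine ⟨η, hη, fun P hP hP' τ hτ w hw hτw => ?_⟩
  obtain ⟨c, hc⟩ := hball τ (hP' τ hτ)
  refine (hP' τ hτ).eq_zero_of_translate_eq
    (hP.eq_of_mem_interior hτw hτ (x := c + w) ?_ (hc ?_))
  · rw [Tile.mem_interior_translate, add_sub_cancel_right]
    exact hc (Metric.mem_ball_self hη)
  · simpa using hw

/-- Only finitely many tiles come near x, and those that miss x are closed, hence miss a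
neighbourhood. -/
theorem eventually_star_subset {T : Set (Tile d M)} (hT : T ∈ Φ.space)
    (x : EuclideanSpace ℝ (Fin d)) : ∀ᶠ y in 𝓝 x, star T y ⊆ star T x := by
  have hp := hasProtoTiles_of_mem_space hT
  have hfin := finite_setOf_mem_inter_ball hT.1.1 hp (‖x‖ + 1)
  have h1 : ∀ᶠ y in 𝓝 x, ∀ τ ∈ {τ ∈ T | ∃ z, ‖z‖ < ‖x‖ + 1 ∧ z ∈ τ.support},
      y ∈ τ.support → x ∈ τ.support := by
    rw [eventually_all_finite hfin]
    intro τ hτ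
    by_cases hx : x ∈ τ.support
    · exact Eventually.of_forall fun _ _ => hx
    · filter_upwards [(hp τ hτ.1).isCompact.isClosed.isOpen_compl.mem_nhds hx] with y hy h
      exact absurd h hy
  have h2 : ∀ᶠ y in 𝓝 x, ‖y‖ < ‖x‖ + 1 :=
    continuous_norm.continuousAt.eventually_lt continuousAt_const (by simp)
  filter_upwards [h1, h2] with y hy1 hy2 τ hτ
  exact ⟨hτ.1, hy1 τ ⟨hτ.1, y, hy2, hτ.2⟩ hτ.2⟩

theorem eventually_star_eq {T T' : Set (Tile d M)} (hT : T ∈ Φ.space) (hT' : T' ∈ Φ.space)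
    {x : EuclideanSpace ℝ (Fin d)} (h : star T x = star T' x) :
    ∀ᶠ y in 𝓝 x, star T y = star T' y := by
  filter_upwards [eventually_star_subset hT x, eventually_star_subset hT' x] with y h1 h2
  ext τ
  constructor
  · intro hτ
    exact ⟨(h ▸ h1 hτ : τ ∈ star T' x).1, hτ.2⟩
  · intro hτ
    exact ⟨(h ▸ h2 hτ : τ ∈ star T x).1, hτ.2⟩

/-- A tile at λ^n x descends from a tile at x, so the star at x governs the star at λ^n x after n
steps. -/
theorem star_iterate_subst_subset {T T' : Set (Tile d M)} (hT : Φ.HasProtoTiles T)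
    {x : EuclideanSpace ℝ (Fin d)} (h : star T x ⊆ T') (n : ℕ) :
    star (Φ.subst^[n] T) (Φ.scale ^ n • x) ⊆ Φ.subst^[n] T' := by
  rintro σ ⟨hσ, hx⟩
  obtain ⟨τ, hτ, hστ⟩ := exists_mem_of_mem_iterate_subst hσ
  have := inv_smul_mem_support_of_mem_iterate (hT τ hτ) hστ hx
  rw [inv_smul_smul₀ (Φ.scale_pow_ne_zero n)] at this
  exact iterate_subst_mono (singleton_subset_iff.2 (h ⟨hτ, this⟩)) n hστ

theorem star_iterate_subst_congr {T T' : Set (Tile d M)} (hT : Φ.HasProtoTiles T)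
    (hT' : Φ.HasProtoTiles T') {x : EuclideanSpace ℝ (Fin d)} (h : star T x = star T' x)
    (n : ℕ) : star (Φ.subst^[n] T) (Φ.scale ^ n • x) =
      star (Φ.subst^[n] T') (Φ.scale ^ n • x) := by
  ext σ
  constructor
  · intro hσ
    exact ⟨star_iterate_subst_subset hT (h.trans_subset (star_subset _ _)) n hσ, hσ.2⟩
  · intro hσ
    exact ⟨star_iterate_subst_subset hT' (h.symm.trans_subset (star_subset _ _)) n hσ, hσ.2⟩

/-! ### The coincidence set. -/

variable (Φ) in
/-- The points at which `T` and `T'` eventually coincide under the substitution. -/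
def coincidenceSet (T T' : Set (Tile d M)) : Set (EuclideanSpace ℝ (Fin d)) :=
  {x | ∃ n : ℕ, star (Φ.subst^[n] T) (Φ.scale ^ n • x) =
    star (Φ.subst^[n] T') (Φ.scale ^ n • x)}

/-- Coincidence persists under further substitution, so different times can be replaced by their
maximum. -/
theorem star_iterate_subst_eq_of_le {T T' : Set (Tile d M)} (hT : Φ.HasProtoTiles T)
    (hT' : Φ.HasProtoTiles T') {x : EuclideanSpace ℝ (Fin d)} {n m : ℕ} (hnm : n ≤ m)
    (h : star (Φ.subst^[n] T) (Φ.scale ^ n • x) = star (Φ.subst^[n] T') (Φ.scale ^ n • x)) :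
    star (Φ.subst^[m] T) (Φ.scale ^ m • x) = star (Φ.subst^[m] T') (Φ.scale ^ m • x) := by
  obtain ⟨k, rfl⟩ := Nat.exists_eq_add_of_le' hnm
  have := star_iterate_subst_congr (hT.iterate_subst n) (hT'.iterate_subst n) h k
  simpa only [← Function.iterate_add_apply, smul_smul, ← pow_add] using this

theorem coincidenceSet_comm (T T' : Set (Tile d M)) :
    Φ.coincidenceSet T T' = Φ.coincidenceSet T' T := by
  ext x
  exact exists_congr fun n => eq_comm

theorem coincidenceSet_trans {T T' T'' : Set (Tile d M)} (hT : Φ.HasProtoTiles T)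
    (hT' : Φ.HasProtoTiles T') (hT'' : Φ.HasProtoTiles T'') {x : EuclideanSpace ℝ (Fin d)}
    (h : x ∈ Φ.coincidenceSet T T') (h' : x ∈ Φ.coincidenceSet T' T'') :
    x ∈ Φ.coincidenceSet T T'' := by
  obtain ⟨n, hn⟩ := h
  obtain ⟨m, hm⟩ := h'
  exact ⟨max n m, (star_iterate_subst_eq_of_le hT hT' (le_max_left n m) hn).trans
    (star_iterate_subst_eq_of_le hT' hT'' (le_max_right n m) hm)⟩

theorem mem_coincidenceSet_of_star_eq {T T' : Set (Tile d M)} {x : EuclideanSpace ℝ (Fin d)}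
    (h : star T x = star T' x) : x ∈ Φ.coincidenceSet T T' :=
  ⟨0, by simpa using h⟩

theorem mem_coincidenceSet_congr {S S' T T' : Set (Tile d M)} (hS : Φ.HasProtoTiles S)
    (hS' : Φ.HasProtoTiles S') (hT : Φ.HasProtoTiles T) (hT' : Φ.HasProtoTiles T')
    {x : EuclideanSpace ℝ (Fin d)} (h : star S x = star T x) (h' : star S' x = star T' x) :
    x ∈ Φ.coincidenceSet S S' ↔ x ∈ Φ.coincidenceSet T T' := by
  constructor
  · intro hx
    exact coincidenceSet_trans hT hS hT' (mem_coincidenceSet_of_star_eq h.symm)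
      (coincidenceSet_trans hS hS' hT' hx (mem_coincidenceSet_of_star_eq h'))
  · intro hx
    exact coincidenceSet_trans hS hT hS' (mem_coincidenceSet_of_star_eq h)
      (coincidenceSet_trans hT hT' hS' hx (mem_coincidenceSet_of_star_eq h'.symm))

theorem mem_coincidenceSet_translate {T T' : Set (Tile d M)} {v x : EuclideanSpace ℝ (Fin d)} :
    x ∈ Φ.coincidenceSet (translate v T) (translate v T') ↔
      x - v ∈ Φ.coincidenceSet T T' := by
  refine exists_congr fun n => ?_
  rw [iterate_subst_translate, iterate_subst_translate, star_translate, star_translate,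
    ← smul_sub, (translate_injective _).eq_iff]

theorem smul_mem_coincidenceSet_iterate {T T' : Set (Tile d M)} (hT : Φ.HasProtoTiles T)
    (hT' : Φ.HasProtoTiles T') {x : EuclideanSpace ℝ (Fin d)} {m : ℕ} :
    Φ.scale ^ m • x ∈ Φ.coincidenceSet (Φ.subst^[m] T) (Φ.subst^[m] T') ↔
      x ∈ Φ.coincidenceSet T T' := by
  constructor
  · rintro ⟨n, hn⟩
    refine ⟨n + m, ?_⟩
    simpa only [← Function.iterate_add_apply, smul_smul, ← pow_add] using hn
  · rintro ⟨n, hn⟩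
    refine ⟨n, ?_⟩
    have := star_iterate_subst_eq_of_le hT hT' (Nat.le_add_right n m) hn
    simpa only [← Function.iterate_add_apply, smul_smul, ← pow_add] using this

/-- On a compact part of the coincidence set the coincidence takes place at a common time. -/
theorem exists_forall_star_eq_of_isCompact {T T' : Set (Tile d M)} (hT : T ∈ Φ.space)
    (hT' : T' ∈ Φ.space) {K : Set (EuclideanSpace ℝ (Fin d))} (hK : IsCompact K)
    (hKT : K ⊆ Φ.coincidenceSet T T') :
    ∃ N : ℕ, ∀ n, N ≤ n → ∀ x ∈ K, star (Φ.subst^[n] T) (Φ.scale ^ n • x) =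
      star (Φ.subst^[n] T') (Φ.scale ^ n • x) := by
  have hp := hasProtoTiles_of_mem_space hT
  have hp' := hasProtoTiles_of_mem_space hT'
  refine hK.induction_on (p := fun K => ∃ N : ℕ, ∀ n, N ≤ n → ∀ x ∈ K,
    star (Φ.subst^[n] T) (Φ.scale ^ n • x) = star (Φ.subst^[n] T') (Φ.scale ^ n • x))
    ⟨0, by simp⟩ ?_ ?_ ?_
  · rintro s t hst ⟨N, hN⟩
    exact ⟨N, fun n hn x hx => hN n hn x (hst hx)⟩
  · rintro s t ⟨N, hN⟩ ⟨N', hN'⟩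
    refine ⟨max N N', fun n hn x hx => ?_⟩
    rcases hx with hx | hx
    · exact hN n ((le_max_left _ _).trans hn) x hx
    · exact hN' n ((le_max_right _ _).trans hn) x hx
  · intro x hx
    obtain ⟨n, hn⟩ := hKT hx
    have h1 := eventually_star_eq (iterate_subst_mem_space hT n)
      (iterate_subst_mem_space hT' n) hn
    have h2 : Tendsto (fun y : EuclideanSpace ℝ (Fin d) => Φ.scale ^ n • y) (𝓝 x)
        (𝓝 (Φ.scale ^ n • x)) := (continuous_const_smul _).tendsto x
    exact ⟨_, mem_nhdsWithin_of_mem_nhds (h2.eventually h1), n,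
      fun m hm y hy => star_iterate_subst_eq_of_le hp hp' hm hy⟩

/-! ### Stable equivalence as coincidence. -/

theorem tilingDist_nonneg (T T' : Set (Tile d M)) : 0 ≤ tilingDist T T' := by
  refine Real.sInf_nonneg ?_
  rintro ε (rfl | hε)
  · positivity
  · exact hε.1.le

theorem tilingDist_le {T T' : Set (Tile d M)} {ε : ℝ} (hε : 0 < ε)
    (h : ballPatch (1 / ε) T' = ballPatch (1 / ε) T) : tilingDist T T' ≤ ε := by
  refine csInf_le ⟨0, ?_⟩ (mem_insert_of_mem _ ⟨hε, 0, 0, by simpa, by simpa, by simpa using h⟩)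
  rintro ε (rfl | hε)
  · positivity
  · exact hε.1.le

/-- Agreement within radius r of the origin spreads to radius λ^k r after k more steps, which bounds
the distance by `(λ^k r)⁻¹`. -/
theorem stablyEquiv_of_zero_mem_coincidenceSet {T T' : Set (Tile d M)} (hT : T ∈ Φ.space)
    (hT' : T' ∈ Φ.space) (h : (0 : EuclideanSpace ℝ (Fin d)) ∈ Φ.coincidenceSet T T') :
    Φ.StablyEquiv T T' := by
  refine ⟨hT, hT', hT, ?_⟩
  obtain ⟨n, hn⟩ := h
  rw [smul_zero] at hn
  have hTn := iterate_subst_mem_space hT n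
  have hTn' := iterate_subst_mem_space hT' n
  obtain ⟨r, hr, hball⟩ := Metric.eventually_nhds_iff.1 (eventually_star_eq hTn hTn' hn)
  rw [← tendsto_add_atTop_iff_nat n]
  have hlim : Tendsto (fun k : ℕ => (Φ.scale ^ k * r)⁻¹) atTop (𝓝 0) :=
    ((tendsto_pow_atTop_atTop_of_one_lt Φ.one_lt_scale).atTop_mul_const hr).inv_tendsto_atTop
  refine squeeze_zero (fun k => tilingDist_nonneg _ _) (fun k => ?_) hlim
  have hpos : 0 < Φ.scale ^ k * r := mul_pos (Φ.scale_pow_pos k) hr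
  refine tilingDist_le (inv_pos.2 hpos) (ballPatch_eq_of_star_eq fun x hx => ?_)
  rw [one_div, inv_inv] at hx
  have h1 : dist ((Φ.scale ^ k)⁻¹ • x) 0 < r := by
    rw [dist_zero_right, norm_smul, norm_inv, norm_pow, Real.norm_of_nonneg Φ.scale_pos.le,
      inv_mul_lt_iff₀ (Φ.scale_pow_pos k)]
    exact hx
  have := star_iterate_subst_congr (hasProtoTiles_of_mem_space hTn)
    (hasProtoTiles_of_mem_space hTn') (hball h1) k
  rw [smul_inv_smul₀ (Φ.scale_pow_ne_zero k), ← Function.iterate_add_apply,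
    ← Function.iterate_add_apply] at this
  exact this.symm

/-- Below 1/2 the cap 1/√2 plays no role, and 1/ε > 2 leaves room for the unit ball after a small
shift. -/
theorem exists_star_translate_eq_of_tilingDist_lt {T T' : Set (Tile d M)} {δ : ℝ}
    (hδ : δ ≤ 1 / 2) (h : tilingDist T T' < δ) :
    ∃ w : EuclideanSpace ℝ (Fin d), ‖w‖ < δ ∧
      ∀ x : EuclideanSpace ℝ (Fin d), ‖x‖ ≤ 1 → star T' x = star (translate w T) x := by
  obtain ⟨ε, hε, hεδ⟩ := exists_lt_of_csInf_lt (insert_nonempty _ _) h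
  rcases hε with rfl | ⟨hε, v, v', hv, hv', he⟩
  · exfalso
    have h1 : Real.sqrt 2 < 2 := by
      rw [Real.sqrt_lt' two_pos]
      norm_num
    have h2 : 1 / 2 < 1 / Real.sqrt 2 := one_div_lt_one_div_of_lt (by positivity) h1
    linarith
  · refine ⟨v' - v, ?_, fun x hx => ?_⟩
    · calc ‖v' - v‖ ≤ ‖v'‖ + ‖v‖ := norm_sub_le _ _
        _ < δ := by linarith
    · have h3 : 2 < 1 / ε := by
        rw [lt_div_iff₀ hε]
        linarith
      have h4 : ‖x - v'‖ < 1 / ε := by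
        calc ‖x - v'‖ ≤ ‖x‖ + ‖v'‖ := norm_sub_le _ _
          _ < 1 / ε := by linarith
      have h5 := star_eq_of_ballPatch_eq he h4
      rw [star_translate, star_translate] at h5
      have h6 := congrArg (TilingSpace.translate v') h5
      rw [TilingSpace.translate_translate, TilingSpace.translate_translate,
        neg_add_cancel, TilingSpace.translate_zero] at h6
      rw [star_translate]
      convert h6 using 2
      · abel_nf
      · abel
      · congr 1
        abel

/-- Eventually the two tilings agree near 0 up to a short offset `w n`. Substituting the agreement
at time n gives the offset λ · `w n` at time n + 1, and tiles of a patch are separated, so `w (n +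
1) = λ • w n`. A bounded sequence of this kind is zero. -/
theorem zero_mem_coincidenceSet_of_stablyEquiv {T T' : Set (Tile d M)}
    (h : Φ.StablyEquiv T T') : (0 : EuclideanSpace ℝ (Fin d)) ∈ Φ.coincidenceSet T T' := by
  obtain ⟨hT, hT', -, hlim⟩ := h
  obtain ⟨η, hη, hsep⟩ := Φ.exists_separation
  -- With δ (λ + 1) ≤ η, the vector `w (n + 1) - λ • w n` is shorter than the separation constant.
  set δ : ℝ := min (1 / 2) (η / (Φ.scale + 1)) with hδdef
  have hs := Φ.scale_pos
  have hδ : 0 < δ := lt_min (by norm_num) (by positivity)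
  obtain ⟨N, hN⟩ := (hlim.eventually (gt_mem_nhds hδ)).exists_forall_of_atTop
  choose! w hw hstar using fun n hn =>
    exists_star_translate_eq_of_tilingDist_lt (min_le_left _ _) (hN n hn)
  have hrec : ∀ n, N ≤ n → w (n + 1) = Φ.scale • w n := by
    intro n hn
    have hTn := iterate_subst_mem_space hT n
    have hTn' := iterate_subst_mem_space hT' n
    have hTn1 := iterate_subst_mem_space hT (n + 1)
    have h0 := hstar n hn 0 (by simp)
    have h1 := star_iterate_subst_congr (hasProtoTiles_of_mem_space hTn')
      ((hasProtoTiles_of_mem_space hTn).translate (w n)) h0 1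
    rw [iterate_subst_translate, ← Function.iterate_add_apply, ← Function.iterate_add_apply,
      smul_zero, pow_one, add_comm 1 n, hstar (n + 1) (by omega) 0 (by simp)] at h1
    obtain ⟨τ, hτ⟩ := (hTn1.1.translate (w (n + 1))).star_nonempty 0
    have hτ2 := hτ
    rw [h1] at hτ2
    have e1 := mem_translate.1 hτ.1
    have e2 := mem_translate.1 hτ2.1
    have e3 : w (n + 1) - Φ.scale • w n = 0 := by
      refine hsep _ hTn1.1.1 (hasProtoTiles_of_mem_space hTn1) _ e1 _ ?_ ?_
      · have l1 := hw n hn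
        have l2 := hw (n + 1) (by omega)
        have l3 : δ * (Φ.scale + 1) ≤ η := by
          rw [← le_div_iff₀ (by positivity)]
          exact min_le_right _ _
        calc ‖w (n + 1) - Φ.scale • w n‖ ≤ ‖w (n + 1)‖ + ‖Φ.scale • w n‖ := norm_sub_le _ _
          _ = ‖w (n + 1)‖ + Φ.scale * ‖w n‖ := by
            rw [norm_smul, Real.norm_of_nonneg hs.le]
          _ < δ + Φ.scale * δ := by gcongr
          _ ≤ η := by linarith
      · rw [Tile.translate_translate]
        convert e2 using 2
        abel
    exact sub_eq_zero.1 e3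
  have hpow : ∀ k, w (N + k) = Φ.scale ^ k • w N := by
    intro k
    induction k with
    | zero => simp
    | succ k ih => rw [← add_assoc, hrec _ (by omega), ih, smul_smul, pow_succ']
  have hw0 : w N = 0 := by
    by_contra hne
    have hpos : 0 < ‖w N‖ := norm_pos_iff.2 hne
    obtain ⟨k, hk⟩ := pow_unbounded_of_one_lt (δ / ‖w N‖) Φ.one_lt_scale
    rw [div_lt_iff₀ hpos] at hk
    have h1 := hw (N + k) (by omega)
    rw [hpow, norm_smul, norm_pow, Real.norm_of_nonneg hs.le] at h1
    linarith
  refine ⟨N, ?_⟩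
  have := hstar N le_rfl 0 (by simp)
  rw [hw0, TilingSpace.translate_zero] at this
  simpa using this.symm

theorem stablyEquiv_translate_iff {T T' : Set (Tile d M)} (hT : T ∈ Φ.space)
    (hT' : T' ∈ Φ.space) {x : EuclideanSpace ℝ (Fin d)} :
    Φ.StablyEquiv (translate (-x) T) (translate (-x) T') ↔ x ∈ Φ.coincidenceSet T T' := by
  have h : (0 : EuclideanSpace ℝ (Fin d)) ∈
      Φ.coincidenceSet (translate (-x) T) (translate (-x) T') ↔ x ∈ Φ.coincidenceSet T T' := by
    rw [mem_coincidenceSet_translate]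
    simp
  rw [← h]
  exact ⟨zero_mem_coincidenceSet_of_stablyEquiv, stablyEquiv_of_zero_mem_coincidenceSet
    (translate_mem_space hT _) (translate_mem_space hT' _)⟩

end SelfSimilarSubstitution

/-! ### Primitivity and local desubstitution. -/

namespace SelfSimilarSubstitution

open TilingSpace

variable {d : ℕ} {M : Type*} {Φ : SelfSimilarSubstitution d M}

/-- Each tile is the closure of its interior, so a tile that touches the interior of another
overlaps it in an open set. -/
theorem eq_of_mem_interior_of_mem {P : Set (Tile d M)} (hP : IsPatch P)
    (hP' : Φ.HasProtoTiles P) {σ ρ : Tile d M} (hσ : σ ∈ P) (hρ : ρ ∈ P)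
    {x : EuclideanSpace ℝ (Fin d)} (hx : x ∈ interior σ.support) (hx' : x ∈ ρ.support) :
    σ = ρ := by
  obtain ⟨y, hy, hy'⟩ := mem_closure_iff.1 ((hP' ρ hρ).subset_closure_interior hx') _
    isOpen_interior hx
  exact hP.eq_of_mem_interior hσ hρ hy hy'

/-- If a patch contains all tiles of the tiling `T` near an open set, then it has no further tiles
there. -/
theorem mem_of_forall_star_subset {T S : Set (Tile d M)} (hT : IsTiling T) (hS : IsPatch S)
    (hS' : Φ.HasProtoTiles S) {U : Set (EuclideanSpace ℝ (Fin d))} (hU : IsOpen U)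
    (h : ∀ y ∈ U, star T y ⊆ S) {σ : Tile d M} (hσ : σ ∈ S) {x : EuclideanSpace ℝ (Fin d)}
    (hxU : x ∈ U) (hx : x ∈ σ.support) : σ ∈ T := by
  obtain ⟨y, hyU, hy⟩ := mem_closure_iff.1 ((hS' σ hσ).subset_closure_interior hx) _ hU hxU
  obtain ⟨τ, hτ, hyτ⟩ := hT.exists_mem y
  rw [eq_of_mem_interior_of_mem hS hS' hσ (h y hyU ⟨hτ, hyτ⟩) hy hyτ]
  exact hτ

theorem eq_of_subset_of_isTiling {T S : Set (Tile d M)} (hT : IsTiling T) (hS : IsPatch S)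
    (hS' : Φ.HasProtoTiles S) (h : T ⊆ S) : T = S := by
  refine h.antisymm fun σ hσ => ?_
  obtain ⟨x, hx⟩ := (hS' σ hσ).nonempty
  exact mem_of_forall_star_subset hT hS hS' isOpen_univ
    (fun y _ => (star_subset T y).trans h) hσ (mem_univ x) hx

theorem translate_iterate_subset_of_mem {P : Set (Tile d M)} {n : ℕ} {i : Fin Φ.numProto}
    {v : EuclideanSpace ℝ (Fin d)} (h : Tile.translate v (Φ.proto i) ∈ Φ.subst^[n] P) (m : ℕ) :
    translate (Φ.scale ^ m • v) (Φ.subst^[m] {Φ.proto i}) ⊆ Φ.subst^[m + n] P := by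
  rw [← iterate_subst_translate, translate_singleton, Function.iterate_add_apply]
  exact iterate_subst_mono (singleton_subset_iff.2 h) m

/-- For equal indices primitivity may be witnessed by n = 0, so one substitution is carried out
first to make the level positive. -/
theorem exists_iterate_mem_self (hprim : Φ.IsPrimitive) (i : Fin Φ.numProto) :
    ∃ n : ℕ, 1 ≤ n ∧ ∃ v, Tile.translate v (Φ.proto i) ∈ Φ.subst^[n] {Φ.proto i} := by
  obtain ⟨x, hx⟩ := Φ.nonempty_proto i
  have h1 : Φ.scale ^ 1 • x ∈ spt (Φ.subst^[1] {Φ.proto i}) := by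
    rw [smul_mem_spt_iterate_subst (hasProtoTiles_singleton (isProtoTile_proto i)),
      spt_singleton]
    exact hx
  obtain ⟨τ, hτ, -⟩ := mem_spt.1 h1
  obtain ⟨j, v, rfl⟩ := hasProtoTiles_subst {Φ.proto i} τ hτ
  obtain ⟨n, w, hw⟩ := hprim i j
  refine ⟨n + 1, by omega, w + Φ.scale ^ n • v, translate_iterate_subset_of_mem hτ n ?_⟩
  rw [mem_translate]
  simpa using hw

theorem exists_ge_translate_iterate_subset (hprim : Φ.IsPrimitive) (i : Fin Φ.numProto)
    (k m : ℕ) : ∃ k', m ≤ k' ∧ ∃ v,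
      translate v (Φ.subst^[k] {Φ.proto i}) ⊆ Φ.subst^[k'] {Φ.proto i} := by
  induction m with
  | zero => exact ⟨k, by omega, 0, by simp⟩
  | succ m ih =>
    obtain ⟨k', hk', v, hv⟩ := ih
    obtain ⟨n, hn, w, hw⟩ := exists_iterate_mem_self hprim i
    refine ⟨k' + n, by omega, v + Φ.scale ^ k' • w, ?_⟩
    rw [← translate_translate]
    exact (translate_mono hv).trans (translate_iterate_subset_of_mem hw k')

/-- A supertile recurs inside supertiles of its own type of arbitrarily high level, which leaves
room to desubstitute any number of times. -/
theorem Allowed.exists_ge (hprim : Φ.IsPrimitive) {P : Set (Tile d M)} (hP : Φ.Allowed P)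
    (m : ℕ) : ∃ k, m ≤ k ∧ ∃ i v, P ⊆ translate v (Φ.subst^[k] {Φ.proto i}) := by
  obtain ⟨k, -, i, v, h⟩ := hP
  obtain ⟨k', hk', w, hw⟩ := exists_ge_translate_iterate_subset hprim i k m
  refine ⟨k', hk', i, -w + -v, h.trans ?_⟩
  rw [← translate_translate]
  refine translate_mono ?_
  rwa [translate_subset_iff] at hw

/-- Iterated prototiles occur in the tilings of the tiling space. -/
theorem exists_mem_space_iterate_subset (hprim : Φ.IsPrimitive) {T : Set (Tile d M)}
    (hT : T ∈ Φ.space) (i : Fin Φ.numProto) (k : ℕ) :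
    ∃ S ∈ Φ.space, Φ.subst^[k] {Φ.proto i} ⊆ S := by
  obtain ⟨τ, hτ, -⟩ := hT.1.exists_mem 0
  obtain ⟨j, z, rfl⟩ := hasProtoTiles_of_mem_space hT τ hτ
  obtain ⟨n, w, hw⟩ := hprim i j
  have h1 := (translate_iterate_subset_of_mem hw k)
  have h2 := translate_iterate_subset_of_mem (n := 0) hτ (k + n)
  have h3 := (translate_mono h1).trans h2
  rw [translate_translate, translate_subset_iff] at h3
  exact ⟨_, translate_mem_space (iterate_subst_mem_space hT (k + n + 0)) _, h3⟩

/-- Local desubstitution: near the origin, a tiling is the `m`-fold substitution of a tiling. -/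
theorem exists_iterate_subst_star_eq (hprim : Φ.IsPrimitive) {T : Set (Tile d M)}
    (hT : T ∈ Φ.space) (m : ℕ) (R : ℝ) : ∃ S ∈ Φ.space, ∀ x : EuclideanSpace ℝ (Fin d),
      ‖x‖ < R → star (Φ.subst^[m] S) (Φ.scale ^ m • x) = star T (Φ.scale ^ m • x) := by
  have hfin := finite_setOf_mem_inter_ball hT.1.1 (hasProtoTiles_of_mem_space hT)
    (Φ.scale ^ m * R)
  -- The finite patch near the origin lies in a supertile of level m + k'. Its level-k' part is
  -- placed in a tiling, and a suitable translate of that tiling is the preimage.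
  obtain ⟨k, hk, i, v, hv⟩ := (hT.2 _ (sep_subset _ _) hfin).exists_ge hprim m
  obtain ⟨k', rfl⟩ := Nat.exists_eq_add_of_le hk
  obtain ⟨S, hS, hsub⟩ := exists_mem_space_iterate_subset hprim hT i k'
  have hS' := translate_mem_space hS ((Φ.scale ^ m)⁻¹ • v)
  have hS'' := iterate_subst_mem_space hS' m
  refine ⟨_, hS', fun x hx => ?_⟩
  have hF : ∀ y : EuclideanSpace ℝ (Fin d), ‖y‖ < Φ.scale ^ m * R →
      star T y ⊆ Φ.subst^[m] (translate ((Φ.scale ^ m)⁻¹ • v) S) := by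
    intro y hy τ hτ
    rw [iterate_subst_translate, smul_inv_smul₀ (Φ.scale_pow_ne_zero m)]
    refine translate_mono ?_ (hv ⟨hτ.1, y, hy, hτ.2⟩)
    rw [Function.iterate_add_apply]
    exact iterate_subst_mono hsub m
  have hx' : ‖Φ.scale ^ m • x‖ < Φ.scale ^ m * R := by
    rw [norm_smul, Real.norm_of_nonneg (Φ.scale_pow_pos m).le]
    exact mul_lt_mul_of_pos_left hx (Φ.scale_pow_pos m)
  ext σ
  constructor
  · intro hσ
    refine ⟨mem_of_forall_star_subset hT.1 hS''.1.1 (hasProtoTiles_of_mem_space hS'')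
      (U := {y | ‖y‖ < Φ.scale ^ m * R}) (isOpen_lt continuous_norm continuous_const)
      hF hσ.1 hx' hσ.2, hσ.2⟩
  · intro hσ
    exact ⟨hF _ hx' hσ, hσ.2⟩

/-! ### Finite local complexity and repetition of patches. -/

/-- The tiles of `T` that meet the ball of radius `R` about `x`. -/
def nearTiles (T : Set (Tile d M)) (x : EuclideanSpace ℝ (Fin d)) (R : ℝ) : Set (Tile d M) :=
  {τ ∈ T | ∃ y, ‖y - x‖ < R ∧ y ∈ τ.support}

theorem nearTiles_subset (T : Set (Tile d M)) (x : EuclideanSpace ℝ (Fin d)) (R : ℝ) :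
    nearTiles T x R ⊆ T := fun _ h => h.1

theorem finite_nearTiles {T : Set (Tile d M)} (hT : T ∈ Φ.space)
    (x : EuclideanSpace ℝ (Fin d)) (R : ℝ) : (nearTiles T x R).Finite := by
  refine (finite_setOf_mem_inter_ball hT.1.1 (hasProtoTiles_of_mem_space hT) (R + ‖x‖)).subset ?_
  rintro τ ⟨hτ, y, hy, hyτ⟩
  refine ⟨hτ, y, ?_, hyτ⟩
  have := norm_add_le (y - x) x
  rw [sub_add_cancel] at this
  linarith

theorem exists_ediam_nearTiles_le (Φ : SelfSimilarSubstitution d M) (R : ℝ) : ∃ R' : ℝ,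
    ∀ T ∈ Φ.space, ∀ x, Metric.ediam (spt (nearTiles T x R)) ≤ ENNReal.ofReal R' := by
  obtain ⟨D, hD, hdiam⟩ := Φ.exists_diam
  refine ⟨2 * (R + D), fun T hT x => ?_⟩
  have key : ∀ y ∈ spt (nearTiles T x R), ‖y - x‖ ≤ R + D := by
    intro y hy
    obtain ⟨τ, ⟨hτ, z, hz, hzτ⟩, hyτ⟩ := mem_spt.1 hy
    have h1 := hdiam τ (hasProtoTiles_of_mem_space hT τ hτ) y hyτ z hzτ
    have h2 := norm_add_le (y - z) (z - x)
    rw [sub_add_sub_cancel] at h2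
    linarith
  refine Metric.ediam_le fun y hy z hz => ?_
  rw [edist_dist]
  refine ENNReal.ofReal_le_ofReal ?_
  have h1 := key y hy
  have h2 := key z hz
  have h3 := dist_triangle_right y z x
  rw [dist_eq_norm y x, dist_eq_norm z x] at h3
  linarith

/-- By finite local complexity, all patches of a given size in a tiling occur in a finite
subpatch. -/
theorem exists_finite_forall_nearTiles (hflc : HasFLC Φ.space) {T : Set (Tile d M)}
    (hT : T ∈ Φ.space) (R : ℝ) : ∃ F ⊆ T, F.Finite ∧
      ∀ x, ∃ v, translate v (nearTiles T x R) ⊆ F := by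
  obtain ⟨R', hR'⟩ := exists_ediam_nearTiles_le Φ R
  obtain ⟨𝓕, hfin, h𝓕⟩ := hflc R'
  choose Q hQ v hv using fun x => h𝓕 T hT (nearTiles T x R) (nearTiles_subset _ _ _) (hR' T hT x)
  obtain ⟨t, ht, hrange⟩ : ∃ t : Set (EuclideanSpace ℝ (Fin d)), t.Finite ∧ Q '' t = range Q := by
    have h1 : (range Q).Finite := hfin.subset (range_subset_iff.2 hQ)
    choose! g hg using fun q (hq : q ∈ range Q) => hq
    refine ⟨g '' range Q, h1.image g, ?_⟩
    rw [image_image]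
    exact (image_congr hg).trans (image_id' _)
  refine ⟨⋃ x ∈ t, nearTiles T x R, iUnion₂_subset fun x _ => nearTiles_subset _ _ _,
    ht.biUnion fun x _ => finite_nearTiles hT x R, fun x => ?_⟩
  obtain ⟨y, hy, hyx⟩ : Q x ∈ Q '' t := hrange ▸ mem_range_self x
  refine ⟨-v x + v y, ?_⟩
  rw [hv x, translate_translate, add_neg_cancel_left, ← hyx, ← hv y]
  exact subset_biUnion_of_mem (u := fun x => nearTiles T x R) hy

/-- Every iterated prototile of a fixed level contains all patches of size `R` of some tiling. -/
theorem exists_level_forall_nearTiles (hprim : Φ.IsPrimitive) (hflc : HasFLC Φ.space)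
    {T : Set (Tile d M)} (hT : T ∈ Φ.space) (R : ℝ) : ∃ L : ℕ, ∀ j, ∃ S ∈ Φ.space,
      ∀ x, ∃ v, translate v (nearTiles S x R) ⊆ Φ.subst^[L] {Φ.proto j} := by
  choose N v hv using hprim
  obtain ⟨a, ha⟩ : ∃ a, ∀ i j, N i j ≤ a :=
    (eventually_all.2 fun i => eventually_all.2 fun j => eventually_ge_atTop (N i j)).exists
  choose F hFT hF hFR using fun b : ℕ =>
    exists_finite_forall_nearTiles hflc (iterate_subst_mem_space hT b) R
  choose G hGT hG hFG using fun b => exists_finite_subset_of_subset_iterate (hF b) (hFT b)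
  -- The level at which type i appears below type j varies with j. One supertile of type i is made
  -- to carry the patches for every number b ≤ a of spare levels, so that k + a serves all j.
  obtain ⟨k, -, i, w, hw⟩ := hT.2 (⋃ b ∈ Iic a, G b) (iUnion₂_subset fun b _ => hGT b)
    ((finite_Iic a).biUnion fun b _ => hG b)
  refine ⟨k + a, fun j => ?_⟩
  have hb : a - N i j ∈ Iic a := Nat.sub_le _ _
  have hN := ha i j
  refine ⟨_, iterate_subst_mem_space hT (a - N i j), fun x => ?_⟩
  obtain ⟨u, hu⟩ := hFR (a - N i j) x
  have h1 := hu.trans (hFG (a - N i j))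
  have h2 := h1.trans (iterate_subst_mono
    ((subset_biUnion_of_mem (u := G) hb).trans hw) (a - N i j))
  rw [iterate_subst_translate, ← Function.iterate_add_apply, smul_neg,
    ← translate_subset_iff] at h2
  have h3 := translate_iterate_subset_of_mem (hv i j) (a - N i j + k)
  have h4 := (translate_mono h2).trans h3
  rw [translate_translate, translate_translate] at h4
  rw [show k + a = a - N i j + k + N i j by omega]
  exact ⟨_, h4⟩

/-! ### Rigidity from non-periodicity. -/

/-- A tiling does not coincide with a small translate of itself on a ball. -/
theorem exists_eq_zero_of_ball_subset_coincidenceSet (hprim : Φ.IsPrimitive)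
    (hflc : HasFLC Φ.space) (hnonper : IsNonPeriodic Φ.space) : ∃ c₀ : ℝ, 0 < c₀ ∧
      ∀ T ∈ Φ.space, ∀ c w, ‖w‖ ≤ c₀ →
        Metric.ball c 1 ⊆ Φ.coincidenceSet T (translate w T) → w = 0 := by
  by_cases hne : ∃ T, T ∈ Φ.space
  swap
  · exact ⟨1, one_pos, fun T hT => absurd ⟨T, hT⟩ hne⟩
  obtain ⟨T₀, hT₀⟩ := hne
  obtain ⟨D, hD, hdiam⟩ := Φ.exists_diam
  obtain ⟨L, hL⟩ := exists_level_forall_nearTiles hprim hflc hT₀ (D + 2)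
  obtain ⟨q, hq⟩ := pow_unbounded_of_one_lt (2 * D) Φ.one_lt_scale
  -- This bound leaves L + q levels above the size of the period: L to contain all patterns of S,
  -- and q to fit the supertile into the ball.
  refine ⟨(Φ.scale ^ (L + q + 1))⁻¹, inv_pos.2 (Φ.scale_pow_pos _), fun T hT c w hw hcoin => ?_⟩
  by_contra hw0
  have hwpos : 0 < ‖w‖ := norm_pos_iff.2 hw0
  obtain ⟨N, hN⟩ := exists_forall_star_eq_of_isCompact hT (translate_mem_space hT w)
    (isCompact_closedBall c (1 / 2))
    ((Metric.closedBall_subset_ball (by norm_num)).trans hcoin)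
  obtain ⟨n, hnN, hn⟩ : ∃ n, N ≤ n ∧ 1 ≤ Φ.scale ^ n * ‖w‖ := by
    have h1 := (tendsto_pow_atTop_atTop_of_one_lt Φ.one_lt_scale).atTop_mul_const hwpos
    exact ((eventually_ge_atTop N).and (h1.eventually_ge_atTop 1)).exists
  -- The inflated period has length in [λ^l, λ^(l+1)), so it is shorter than one unit at level l +
  -- 1.
  obtain ⟨l, hl1, hl2⟩ := exists_nat_pow_near hn Φ.one_lt_scale
  have hlen : l + 1 + L + q ≤ n := by
    have h1 : Φ.scale ^ l * Φ.scale ^ (L + q + 1) ≤ Φ.scale ^ n := by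
      rw [← le_div_iff₀ (Φ.scale_pow_pos _), div_eq_mul_inv]
      exact hl1.trans (mul_le_mul_of_nonneg_left hw (Φ.scale_pow_pos n).le)
    rw [← pow_add, pow_le_pow_iff_right₀ Φ.one_lt_scale] at h1
    omega
  obtain ⟨m, rfl⟩ : ∃ m, n = l + 1 + L + m := ⟨n - (l + 1 + L), by omega⟩
  set n := l + 1 + L + m with hndef
  set W := Φ.scale ^ n • w with hW
  have hTn := iterate_subst_mem_space hT n
  have hTnp := hasProtoTiles_of_mem_space hTn
  have hTm := iterate_subst_mem_space hT m
  obtain ⟨η, hη, hcη⟩ := hTm.1.exists_mem (Φ.scale ^ m • c)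
  have hηp := hasProtoTiles_of_mem_space hTm η hη
  have hsub : Φ.subst^[l + 1 + L] {η} ⊆ Φ.subst^[n] T := by
    rw [hndef, Function.iterate_add_apply Φ.subst (l + 1 + L) m]
    exact iterate_subst_mono (singleton_subset_iff.2 hη) _
  -- Scaled back by λ^n, the supertile of η lies within D / λ^m ≤ 1/2 of c, where the coincidence
  -- has already taken place.
  have hshift : ∀ σ ∈ Φ.subst^[l + 1 + L] {η}, Tile.translate (-W) σ ∈ Φ.subst^[n] T := by
    intro σ hσ
    obtain ⟨p, hp⟩ := (hTnp σ (hsub hσ)).nonempty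
    have h1 := hdiam η hηp _ (inv_smul_mem_support_of_mem_iterate hηp hσ hp) _ hcη
    have h2 : (Φ.scale ^ n)⁻¹ • p ∈ Metric.closedBall c (1 / 2) := by
      rw [mem_closedBall_iff_norm]
      have h3 : (Φ.scale ^ n)⁻¹ • p - c =
          (Φ.scale ^ m)⁻¹ • ((Φ.scale ^ (l + 1 + L))⁻¹ • p - Φ.scale ^ m • c) := by
        rw [smul_sub, inv_smul_smul₀ (Φ.scale_pow_ne_zero m), smul_smul, ← mul_inv, ← pow_add,
          hndef, add_comm m]
      rw [h3, norm_smul, norm_inv, Real.norm_of_nonneg (Φ.scale_pow_pos m).le,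
        inv_mul_le_iff₀ (Φ.scale_pow_pos m)]
      have h4 : Φ.scale ^ q ≤ Φ.scale ^ m :=
        pow_le_pow_right₀ Φ.one_lt_scale.le (by omega)
      linarith
    have h5 := hN n hnN _ h2
    rw [smul_inv_smul₀ (Φ.scale_pow_ne_zero n), iterate_subst_translate] at h5
    have h6 : σ ∈ star (Φ.subst^[n] T) p := ⟨hsub hσ, hp⟩
    rw [h5] at h6
    exact mem_translate.1 h6.1
  obtain ⟨j, z, rfl⟩ := hηp
  obtain ⟨S, hS, hSj⟩ := hL j
  have hU := iterate_subst_mem_space hS (l + 1)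
  have hSp := hasProtoTiles_of_mem_space hS
  -- A tile of Φ^(l+1)(S) is copied with its surroundings into the supertile of η and shifted there
  -- by -W. Radius D + 2 covers a parent tile and the shift, so the result overlaps a tile of the
  -- copy and equals it.
  have hper : translate (-W) (Φ.subst^[l + 1] S) ⊆ Φ.subst^[l + 1] S := by
    rintro _ ⟨σ, hσ, rfl⟩
    obtain ⟨τ, hτ, hστ⟩ := exists_mem_of_mem_iterate_subst hσ
    obtain ⟨x, hx⟩ := (hSp τ hτ).nonempty
    obtain ⟨v, hv⟩ := hSj x
    have hemb : translate (Φ.scale ^ (l + 1) • v + Φ.scale ^ (l + 1 + L) • z)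
        (Φ.subst^[l + 1] (nearTiles S x (D + 2))) ⊆
        Φ.subst^[l + 1 + L] {Tile.translate z (Φ.proto j)} := by
      have h1 := iterate_subst_mono (Φ := Φ) hv (l + 1)
      rw [iterate_subst_translate, ← Function.iterate_add_apply] at h1
      rw [← translate_singleton, iterate_subst_translate, ← translate_translate]
      exact translate_mono h1
    set V := Φ.scale ^ (l + 1) • v + Φ.scale ^ (l + 1 + L) • z
    have hτnear : τ ∈ nearTiles S x (D + 2) := ⟨hτ, x, by simp; linarith, hx⟩
    have hσnear : σ ∈ Φ.subst^[l + 1] (nearTiles S x (D + 2)) :=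
      iterate_subst_mono (singleton_subset_iff.2 hτnear) _ hστ
    have hσV : Tile.translate V (Tile.translate (-W) σ) ∈ Φ.subst^[n] T := by
      have := hshift _ (hemb (translate_mem_translate hσnear))
      rw [Tile.translate_translate] at this ⊢
      rwa [add_comm]
    have hσVp := hTnp _ hσV
    obtain ⟨y', hy'⟩ : (interior (Tile.translate V (Tile.translate (-W) σ)).support).Nonempty := by
      rw [← closure_nonempty_iff]
      exact hσVp.nonempty.mono hσVp.subset_closure_interior
    have hy : y' - V ∈ (Tile.translate (-W) σ).support := by
      rw [← Tile.mem_support_translate]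
      exact interior_subset hy'
    have hyW : (Φ.scale ^ (l + 1))⁻¹ • (y' - V + W) ∈ τ.support := by
      refine inv_smul_mem_support_of_mem_iterate (hSp τ hτ) hστ ?_
      rwa [Tile.mem_support_translate, sub_neg_eq_add] at hy
    have hnear : ‖(Φ.scale ^ (l + 1))⁻¹ • (y' - V) - x‖ < D + 2 := by
      have e1 := hdiam τ (hSp τ hτ) _ hyW x hx
      have e2 : ‖(Φ.scale ^ (l + 1))⁻¹ • W‖ ≤ 1 := by
        rw [norm_smul, norm_inv, Real.norm_of_nonneg (Φ.scale_pow_pos _).le,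
          inv_mul_le_iff₀ (Φ.scale_pow_pos _), hW, norm_smul,
          Real.norm_of_nonneg (Φ.scale_pow_pos _).le, mul_one]
        exact hl2.le
      have e3 : (Φ.scale ^ (l + 1))⁻¹ • (y' - V) - x =
          ((Φ.scale ^ (l + 1))⁻¹ • (y' - V + W) - x) - (Φ.scale ^ (l + 1))⁻¹ • W := by
        rw [smul_add]
        abel
      rw [e3]
      have e4 := norm_sub_le ((Φ.scale ^ (l + 1))⁻¹ • (y' - V + W) - x)
        ((Φ.scale ^ (l + 1))⁻¹ • W)
      linarith
    have hspt : y' - V ∈ spt (Φ.subst^[l + 1] (nearTiles S x (D + 2))) := by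
      rw [mem_spt_iterate_subst (hSp.mono (nearTiles_subset _ _ _))]
      obtain ⟨τ', hτ', hyτ'⟩ := hS.1.exists_mem ((Φ.scale ^ (l + 1))⁻¹ • (y' - V))
      exact mem_spt.2 ⟨τ', ⟨hτ', _, hnear, hyτ'⟩, hyτ'⟩
    obtain ⟨ρ, hρ, hyρ⟩ := mem_spt.1 hspt
    have heq := eq_of_mem_interior_of_mem hTn.1.1 hTnp hσV
      (hsub (hemb (translate_mem_translate hρ))) hy' (Tile.mem_support_translate.2 hyρ)
    have heq' := congrArg (Tile.translate (-V)) heq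
    simp only [Tile.translate_translate, add_assoc, add_neg_cancel, add_zero,
      Tile.translate_zero] at heq'
    rw [heq']
    exact iterate_subst_mono (nearTiles_subset _ _ _) _ hρ
  have hW0 : W = 0 := hnonper _ hU W
    (eq_of_subset_of_isTiling (hU.1.translate (-W)) hU.1.1 (hasProtoTiles_of_mem_space hU) hper)
  exact hw0 ((smul_eq_zero.1 hW0).resolve_left (Φ.scale_pow_ne_zero n))

end SelfSimilarSubstitution

/-! ### Patch codes and boundary configurations. -/

namespace SelfSimilarSubstitution

open TilingSpace

variable {d : ℕ} {M : Type*} {Φ : SelfSimilarSubstitution d M}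

theorem star_eq_of_nearTiles_eq {S T : Set (Tile d M)} {R : ℝ}
    {y : EuclideanSpace ℝ (Fin d)} (h : nearTiles S 0 R = translate y (nearTiles T 0 R))
    {x : EuclideanSpace ℝ (Fin d)} (hx : ‖x‖ < R) (hx' : ‖x - y‖ < R) :
    star S x = star (translate y T) x := by
  ext τ
  constructor
  · intro hτ
    have h1 : τ ∈ nearTiles S 0 R := ⟨hτ.1, x, by simpa using hx, hτ.2⟩
    rw [h] at h1
    exact ⟨translate_mono (nearTiles_subset _ _ _) h1, hτ.2⟩
  · intro hτ
    have h1 : τ ∈ translate y (nearTiles T 0 R) := by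
      rw [mem_translate]
      refine ⟨mem_translate.1 hτ.1, x - y, by simpa using hx', ?_⟩
      rw [Tile.mem_support_translate]
      simpa using hτ.2
    rw [← h] at h1
    exact ⟨h1.1, hτ.2⟩

theorem exists_finite_net (R : ℝ) {δ : ℝ} (hδ : 0 < δ) :
    ∃ (N : Set (EuclideanSpace ℝ (Fin d)))
      (f : EuclideanSpace ℝ (Fin d) → EuclideanSpace ℝ (Fin d)), N.Finite ∧
      ∀ x, ‖x‖ ≤ R → f x ∈ N ∧ ‖x - f x‖ < δ := by
  obtain ⟨N, -, hN, hcov⟩ := (isCompact_closedBall (0 : EuclideanSpace ℝ (Fin d))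
    R).finite_cover_balls hδ
  have h1 : ∀ x : EuclideanSpace ℝ (Fin d), ‖x‖ ≤ R → ∃ y ∈ N, ‖x - y‖ < δ := by
    intro x hx
    have h2 := hcov (mem_closedBall_zero_iff.2 hx)
    simpa [dist_eq_norm] using h2
  choose! f hf using h1
  exact ⟨N, f, hN, hf⟩

/-- Up to small translations there are only finitely many patches of size `R` about the origin. -/
theorem exists_finite_patch_codes (hflc : HasFLC Φ.space) {R : ℝ} (hR : 0 < R) {δ : ℝ}
    (hδ : 0 < δ) :
    ∃ (C : Set (Set (Tile d M) × EuclideanSpace ℝ (Fin d)))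
      (code : Set (Tile d M) → Set (Tile d M) × EuclideanSpace ℝ (Fin d)), C.Finite ∧
      ∀ S ∈ Φ.space, code S ∈ C ∧ ∀ S' ∈ Φ.space, code S' = code S →
        ∃ y, ‖y‖ < δ ∧ nearTiles S' 0 R = translate y (nearTiles S 0 R) := by
  obtain ⟨R', hR'⟩ := exists_ediam_nearTiles_le Φ R
  obtain ⟨𝓕, hfin, h𝓕⟩ := hflc R'
  obtain ⟨D, hD, hdiam⟩ := Φ.exists_diam
  choose! Q hQ v hv using fun S (hS : S ∈ Φ.space) =>
    h𝓕 S hS (nearTiles S 0 R) (nearTiles_subset _ _ _) (hR' S hS 0)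
  -- Tilings with the same representative have bounded relative offsets: the tile of one at 0 is
  -- carried to a tile of the other that meets the ball of radius R.
  have hbound : ∀ P ∈ 𝓕, ∀ᶠ B in atTop, ∀ S ∈ Φ.space, Q S = P → ‖v S‖ ≤ B := by
    intro P hP
    by_cases hex : ∃ S ∈ Φ.space, Q S = P
    · obtain ⟨S₀, hS₀, rfl⟩ := hex
      filter_upwards [eventually_ge_atTop (2 * (R + D) + ‖v S₀‖)] with B hB S hS hSQ
      obtain ⟨τ, hτ, h0⟩ := hS.1.exists_mem 0
      have h1 : τ ∈ nearTiles S 0 R := ⟨hτ, 0, by simpa using hR, h0⟩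
      rw [hv S hS, hSQ, mem_translate] at h1
      have h2 := translate_mem_translate (v := v S₀) h1
      rw [← hv S₀ hS₀, Tile.translate_translate] at h2
      obtain ⟨-, z, hz, hzτ⟩ := h2
      rw [Tile.mem_support_translate] at hzτ
      rw [sub_zero] at hz
      have h3 := hdiam τ (hasProtoTiles_of_mem_space hS τ hτ) _ hzτ _ h0
      have h4 : v S = (z - (-v S + v S₀) - 0) - z + v S₀ := by abel
      rw [h4]
      refine (norm_add_le _ _).trans ?_
      have h5 := norm_sub_le (z - (-v S + v S₀) - 0) z
      linarith
    · exact Eventually.of_forall fun B S hS hSQ => absurd ⟨S, hS, hSQ⟩ hex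
  obtain ⟨B, hB⟩ := ((eventually_all_finite hfin).2 hbound).exists
  obtain ⟨N, f, hN, hf⟩ := exists_finite_net (d := d) B (half_pos hδ)
  refine ⟨𝓕 ×ˢ N, fun S => (Q S, f (v S)), hfin.prod hN, fun S hS => ⟨⟨hQ S hS, ?_⟩, ?_⟩⟩
  · exact (hf _ (hB _ (hQ S hS) S hS rfl)).1
  · intro S' hS' he
    obtain ⟨he1, he2⟩ := Prod.mk.inj he
    refine ⟨v S' - v S, ?_, ?_⟩
    · have h1 := (hf _ (hB _ (hQ S hS) S hS rfl)).2
      have h2 := (hf _ (hB _ (hQ S' hS') S' hS' rfl)).2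
      rw [he2] at h2
      have h3 := norm_sub_le (v S' - f (v S)) (v S - f (v S))
      rw [sub_sub_sub_cancel_right] at h3
      linarith
    · rw [hv S' hS', hv S hS, he1, translate_translate]
      congr 1
      abel

/-- The points `0` and `x` lie outside of the coincidence set of `S` and `S'`, approximately on the
boundary of an open half-disc of radius `R` with inner normal `n` that lies inside. -/
structure IsBoundaryConfig (Φ : SelfSimilarSubstitution d M) (R ε : ℝ)
    (n x : EuclideanSpace ℝ (Fin d)) (S S' : Set (Tile d M)) : Prop where
  left_mem : S ∈ Φ.space
  right_mem : S' ∈ Φ.space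
  one_le_norm : 1 ≤ ‖x‖
  norm_le : ‖x‖ ≤ Φ.scale
  abs_inner_le : |inner ℝ x n| ≤ ε
  zero_notMem : 0 ∉ Φ.coincidenceSet S S'
  notMem : x ∉ Φ.coincidenceSet S S'
  mem_of_inner_pos : ∀ z : EuclideanSpace ℝ (Fin d), ‖z‖ < R → 0 < inner ℝ z n →
    z ∈ Φ.coincidenceSet S S'

theorem IsBoundaryConfig.mono {R ε ε' : ℝ} {n x : EuclideanSpace ℝ (Fin d)}
    {S S' : Set (Tile d M)} (h : Φ.IsBoundaryConfig R ε n x S S') (hε : ε ≤ ε') :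
    Φ.IsBoundaryConfig R ε' n x S S' :=
  { h with abs_inner_le := h.abs_inner_le.trans hε }

/-- Two boundary configurations with nearly equal positions and normals differ by a common
translation, and neither half-disc contains the excluded points of the other configuration. -/
theorem IsBoundaryConfig.inner_le {c₀ δ R ε : ℝ}
    (hc₀ : ∀ T ∈ Φ.space, ∀ c w, ‖w‖ ≤ c₀ →
      Metric.ball c 1 ⊆ Φ.coincidenceSet T (translate w T) → w = 0)
    (hδc : 2 * δ ≤ c₀) (hδ : δ ≤ 1 / 8) (hR : Φ.scale + 5 ≤ R)
    {n₁ n₂ x₁ x₂ y y' : EuclideanSpace ℝ (Fin d)} {S₁ S₂ S₁' S₂' : Set (Tile d M)}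
    (h₁ : Φ.IsBoundaryConfig R ε n₁ x₁ S₁ S₁') (h₂ : Φ.IsBoundaryConfig R ε n₂ x₂ S₂ S₂')
    (hn₁ : ‖n₁‖ = 1) (hn₂ : ‖n₂‖ = 1) (hn : ‖n₁ - n₂‖ < δ) (hy : ‖y‖ < δ) (hy' : ‖y'‖ < δ)
    (hS : nearTiles S₂ 0 R = translate y (nearTiles S₁ 0 R))
    (hS' : nearTiles S₂' 0 R = translate y' (nearTiles S₁' 0 R)) :
    inner ℝ y n₂ ≤ 0 ∧ inner ℝ (x₁ + y) n₂ ≤ 0 ∧ 0 ≤ inner ℝ y n₁ ∧ inner ℝ (x₂ - y) n₁ ≤ 0 := by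
  have hs := Φ.one_lt_scale
  have p₁ := hasProtoTiles_of_mem_space h₁.left_mem
  have p₂ := hasProtoTiles_of_mem_space h₂.left_mem
  have p₁' := hasProtoTiles_of_mem_space h₁.right_mem
  have p₂' := hasProtoTiles_of_mem_space h₂.right_mem
  -- The margin in R keeps z + y and its shifts back within the region where the patches agree.
  have key : ∀ z : EuclideanSpace ℝ (Fin d), ‖z‖ < Φ.scale + 4 →
      (z + y ∈ Φ.coincidenceSet S₂ S₂' ↔
        z ∈ Φ.coincidenceSet S₁ (translate (y' - y) S₁')) := by
    intro z hz
    have e1 : ‖z + y‖ < R := (norm_add_le _ _).trans_lt (by linarith)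
    rw [mem_coincidenceSet_congr p₂ p₂' (p₁.translate y) (p₁'.translate y')
      (star_eq_of_nearTiles_eq hS e1 ?_) (star_eq_of_nearTiles_eq hS' e1 ?_)]
    · rw [show y' = (y' - y) + y by abel, ← translate_translate, mem_coincidenceSet_translate]
      simp
    · rw [add_sub_cancel_right]
      linarith
    · have := norm_sub_le (z + y) y'
      have := norm_add_le z y
      linarith
  -- This ball lies deep in the first half-plane, and for δ ≤ 1/8 its shift by y lies in the second.
  -- Both coincidences there combine, through S₁, to one of S₁' with its own translate.
  have hball : Metric.ball ((2 : ℝ) • n₁) 1 ⊆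
      Φ.coincidenceSet S₁' (translate (y' - y) S₁') := by
    intro z hz
    rw [mem_ball_iff_norm] at hz
    have hz2 : ‖z‖ < 3 := by
      have h3 := norm_add_le (z - (2 : ℝ) • n₁) ((2 : ℝ) • n₁)
      rw [sub_add_cancel, norm_smul, hn₁, Real.norm_of_nonneg zero_le_two] at h3
      linarith
    have hzn : 1 < inner ℝ z n₁ := by
      have h3 : inner ℝ z n₁ = 2 + inner ℝ (z - (2 : ℝ) • n₁) n₁ := by
        rw [inner_sub_left, real_inner_smul_left, real_inner_self_eq_norm_sq, hn₁]
        ring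
      have h4 := neg_le_of_abs_le (abs_real_inner_le_norm (z - (2 : ℝ) • n₁) n₁)
      rw [hn₁, mul_one] at h4
      linarith
    have hzn2 : 0 < inner ℝ (z + y) n₂ := by
      have h3 : inner ℝ (z + y) n₂ = inner ℝ z n₁ - inner ℝ z (n₁ - n₂) + inner ℝ y n₂ := by
        rw [inner_sub_right, inner_add_left]
        ring
      have h4 := le_of_abs_le (abs_real_inner_le_norm z (n₁ - n₂))
      have h5 := neg_le_of_abs_le (abs_real_inner_le_norm y n₂)
      have h6 : ‖z‖ * ‖n₁ - n₂‖ ≤ 3 * δ :=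
        mul_le_mul hz2.le hn.le (norm_nonneg _) (by norm_num)
      rw [hn₂, mul_one] at h5
      linarith
    have h1 := h₁.mem_of_inner_pos z (by linarith) (by linarith)
    have h2 := h₂.mem_of_inner_pos (z + y) ((norm_add_le _ _).trans_lt (by linarith)) hzn2
    rw [key z (by linarith)] at h2
    exact coincidenceSet_trans p₁' p₁ (p₁'.translate _)
      (by rwa [coincidenceSet_comm]) h2
  have hyy : y' - y = 0 := by
    refine hc₀ _ h₁.right_mem _ _ ?_ hball
    exact (norm_sub_le _ _).trans (by linarith)
  simp only [hyy, TilingSpace.translate_zero] at key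
  have hx₁ := h₁.norm_le
  have hx₂ := h₂.norm_le
  have out₂ : ∀ z : EuclideanSpace ℝ (Fin d), ‖z‖ ≤ Φ.scale →
      z ∉ Φ.coincidenceSet S₁ S₁' → inner ℝ (z + y) n₂ ≤ 0 := by
    intro z hz hz'
    by_contra! h
    exact hz' ((key z (by linarith)).1 (h₂.mem_of_inner_pos _
      ((norm_add_le _ _).trans_lt (by linarith)) h))
  have out₁ : ∀ z : EuclideanSpace ℝ (Fin d), ‖z‖ ≤ Φ.scale →
      z ∉ Φ.coincidenceSet S₂ S₂' → inner ℝ (z - y) n₁ ≤ 0 := by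
    intro z hz hz'
    by_contra! h
    have h3 : ‖z - y‖ < Φ.scale + 4 := (norm_sub_le _ _).trans_lt (by linarith)
    have h4 := (key (z - y) h3).2 (h₁.mem_of_inner_pos _ (by linarith) h)
    rw [sub_add_cancel] at h4
    exact hz' h4
  refine ⟨?_, out₂ _ hx₁ h₁.notMem, ?_, out₁ _ hx₂ h₂.notMem⟩
  · simpa using out₂ 0 (by simp; linarith) h₁.zero_notMem
  · simpa using out₁ 0 (by simp; linarith) h₂.zero_notMem

end SelfSimilarSubstitution

/-! ### Two lines in the plane. -/

section Plane

theorem inner_fin_two (x y : EuclideanSpace ℝ (Fin 2)) :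
    inner ℝ x y = x 0 * y 0 + x 1 * y 1 := by
  simp [PiLp.inner_apply, Fin.sum_univ_two, mul_comm]

theorem norm_sq_fin_two (x : EuclideanSpace ℝ (Fin 2)) : ‖x‖ ^ 2 = x 0 ^ 2 + x 1 ^ 2 := by
  rw [EuclideanSpace.norm_sq_eq, Fin.sum_univ_two]
  simp

/-- The rotation of the plane by a right angle. -/
def quarterTurn (x : EuclideanSpace ℝ (Fin 2)) : EuclideanSpace ℝ (Fin 2) :=
  !₂[-x 1, x 0]

@[simp] theorem quarterTurn_apply_zero (x : EuclideanSpace ℝ (Fin 2)) :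
    quarterTurn x 0 = -x 1 := rfl

@[simp] theorem quarterTurn_apply_one (x : EuclideanSpace ℝ (Fin 2)) :
    quarterTurn x 1 = x 0 := rfl

theorem norm_quarterTurn (x : EuclideanSpace ℝ (Fin 2)) : ‖quarterTurn x‖ = ‖x‖ := by
  rw [← sq_eq_sq₀ (norm_nonneg _) (norm_nonneg _), norm_sq_fin_two, norm_sq_fin_two]
  simp [add_comm]

/-- Two nearly equal lines that both support two far apart pairs of nearby points are parallel:
coordinate form. -/
theorem false_of_crossing {α β p q ξ₁ ξ₂ ν₁ ν₂ ε : ℝ} (hαβ : α ^ 2 + β ^ 2 = 1)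
    (hα : 1 / 2 ≤ α) (hp : 0 ≤ p) (hq : |q| ≤ 1 / 8) (hξ₁ : 1 / 2 ≤ ξ₁) (hξ₂ : 1 / 2 ≤ ξ₂)
    (hν₁ : |ν₁| ≤ ε) (hν₂ : |ν₂| ≤ ε) (hε : ε < |β| / 8)
    (h1 : α * p + β * q ≤ 0) (h2 : β * ξ₁ + α * ν₁ + (α * p + β * q) ≤ 0)
    (h3 : -β * ξ₂ + α * ν₂ - p ≤ 0) : False := by
  have hα1 : α ≤ 1 := by nlinarith [sq_nonneg β]
  have hαp : p / 2 ≤ α * p := by nlinarith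
  have hbound : ∀ ν, |ν| ≤ ε → -ε ≤ α * ν := by
    intro ν hν
    have h4 : |α * ν| ≤ ε := by
      rw [abs_mul, abs_of_nonneg (by linarith : (0 : ℝ) ≤ α)]
      nlinarith [abs_nonneg ν]
    exact (abs_le.1 h4).1
  have h5 := hbound ν₁ hν₁
  have h6 := hbound ν₂ hν₂
  obtain ⟨hq1, hq2⟩ := abs_le.1 hq
  -- The sign of β decides which far point violates its inequality: for β ≥ 0 it is `h2`; otherwise
  -- `h1` gives p ≤ |β|/4, and `h3` fails.
  rcases le_total 0 β with hβ | hβ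
  · rw [abs_of_nonneg hβ] at hε
    have h7 : β * (1 / 2) ≤ β * ξ₁ := mul_le_mul_of_nonneg_left hξ₁ hβ
    have h8 : β * (-(1 / 8)) ≤ β * q := mul_le_mul_of_nonneg_left hq1 hβ
    linarith
  · rw [abs_of_nonpos hβ] at hε
    have h7 : -β * (1 / 2) ≤ -β * ξ₂ := mul_le_mul_of_nonneg_left hξ₂ (by linarith)
    have h8 : -β * q ≤ -β * (1 / 8) := mul_le_mul_of_nonneg_left hq2 (by linarith)
    linarith

/-- In a common frame the second line passes through -y and nearly through x₂ - y. The inequalities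
put each line on or below the other near 0 and again near x₁, up to ε, whereas lines at an angle of
order ‖n₁ - n₂‖ separate by more than that at one of the two places. -/
theorem eq_of_crossing {n₁ n₂ y x₁ x₂ : EuclideanSpace ℝ (Fin 2)} {ε : ℝ}
    (hn₁ : ‖n₁‖ = 1) (hn₂ : ‖n₂‖ = 1) (hn : ‖n₁ - n₂‖ ≤ 1 / 8)
    (hnx : ‖n₁ - n₂‖ * ‖x₁‖ ≤ 1 / 8) (hy : ‖y‖ ≤ 1 / 8) (hx : ‖x₁ - x₂‖ ≤ 1 / 8)
    (hx₁ : 1 ≤ ‖x₁‖) (hν₁ : |inner ℝ x₁ n₁| ≤ ε) (hν₂ : |inner ℝ x₂ n₂| ≤ ε)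
    (hε : ε < ‖n₁ - n₂‖ / 16)
    (h1 : inner ℝ y n₂ ≤ 0) (h2 : inner ℝ (x₁ + y) n₂ ≤ 0) (h3 : 0 ≤ inner ℝ y n₁)
    (h4 : inner ℝ (x₂ - y) n₁ ≤ 0) : False := by
  -- The sign s orients the tangent towards x₁.
  obtain ⟨s, hs, hsx⟩ : ∃ s : ℝ, s ^ 2 = 1 ∧ 0 ≤ s * inner ℝ x₁ (quarterTurn n₁) := by
    rcases le_total 0 (inner ℝ x₁ (quarterTurn n₁)) with h | h
    · exact ⟨1, by norm_num, by simpa using h⟩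
    · exact ⟨-1, by norm_num, by simpa using h⟩
  have habs : |s| = 1 := by
    rw [← sq_eq_sq₀ (abs_nonneg s) zero_le_one, sq_abs, hs, one_pow]
  have e1 := norm_sq_fin_two n₁
  have e2 := norm_sq_fin_two n₂
  rw [hn₁, one_pow] at e1
  rw [hn₂, one_pow] at e2
  have hε' : ε ≤ 1 / 128 := by linarith
  -- far points have large tangential coordinates
  have hxi : ∀ {n x : EuclideanSpace ℝ (Fin 2)}, ‖n‖ = 1 → 1 ≤ ‖x‖ → |inner ℝ x n| ≤ ε →
      3 / 4 ≤ |s * inner ℝ x (quarterTurn n)| := by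
    intro n x hn hx hν
    rw [abs_mul, habs, one_mul]
    have e3 := norm_sq_fin_two n
    have e4 := norm_sq_fin_two x
    rw [hn, one_pow] at e3
    have e5 : inner ℝ x n ^ 2 + inner ℝ x (quarterTurn n) ^ 2 = ‖x‖ ^ 2 := by
      rw [inner_fin_two, inner_fin_two, e4]
      simp only [quarterTurn_apply_zero, quarterTurn_apply_one]
      linear_combination -(x 0 ^ 2 + x 1 ^ 2) * e3
    have e6 : inner ℝ x n ^ 2 ≤ (1 / 128) ^ 2 := by
      rw [← sq_abs]
      exact pow_le_pow_left₀ (abs_nonneg _) (hν.trans hε') 2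
    refine abs_le_of_sq_le_sq' ?_ (abs_nonneg _) |>.2
    rw [sq_abs]
    nlinarith
  have hξ₁ : 3 / 4 ≤ s * inner ℝ x₁ (quarterTurn n₁) := by
    have := hxi hn₁ hx₁ hν₁
    rwa [abs_of_nonneg hsx] at this
  have hqt : quarterTurn n₁ - quarterTurn n₂ = quarterTurn (n₁ - n₂) := by
    ext i
    fin_cases i
    · simp
      ring
    · simp
  have hξ₂ : 1 / 2 ≤ s * inner ℝ x₂ (quarterTurn n₂) := by
    have e3 : s * inner ℝ x₂ (quarterTurn n₂) = s * inner ℝ x₁ (quarterTurn n₁) -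
        s * inner ℝ x₁ (quarterTurn n₁ - quarterTurn n₂) -
        s * inner ℝ (x₁ - x₂) (quarterTurn n₂) := by
      rw [inner_sub_left, inner_sub_right]
      ring
    have e4 : s * inner ℝ x₁ (quarterTurn n₁ - quarterTurn n₂) ≤ 1 / 8 := by
      refine (le_abs_self _).trans ?_
      rw [abs_mul, habs, one_mul, hqt]
      refine (abs_real_inner_le_norm _ _).trans ?_
      rw [norm_quarterTurn, mul_comm]
      exact hnx
    have e5 : s * inner ℝ (x₁ - x₂) (quarterTurn n₂) ≤ 1 / 8 := by
      refine (le_abs_self _).trans ?_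
      rw [abs_mul, habs, one_mul]
      refine (abs_real_inner_le_norm _ _).trans ?_
      rw [norm_quarterTurn, hn₂, mul_one]
      exact hx
    linarith
  have hβn : ‖n₁ - n₂‖ ≤ 2 * |s * inner ℝ (quarterTurn n₁) n₂| ∧
      1 / 2 ≤ (inner ℝ n₁ n₂ : ℝ) := by
    rw [abs_mul, habs, one_mul]
    have e3 : ‖n₁ - n₂‖ ^ 2 = 2 - 2 * inner ℝ n₁ n₂ := by
      rw [norm_sub_sq_real, hn₁, hn₂]
      ring
    have e4 : ‖n₁ - n₂‖ ^ 2 ≤ (1 / 8) ^ 2 := pow_le_pow_left₀ (norm_nonneg _) hn 2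
    have e5 : (inner ℝ n₁ n₂ : ℝ) ^ 2 + inner ℝ (quarterTurn n₁) n₂ ^ 2 = 1 := by
      rw [inner_fin_two, inner_fin_two]
      simp only [quarterTurn_apply_zero, quarterTurn_apply_one]
      linear_combination -(n₂ 0 ^ 2 + n₂ 1 ^ 2) * e1 - e2
    have e6 : 1 / 2 ≤ (inner ℝ n₁ n₂ : ℝ) := by linarith
    refine ⟨?_, e6⟩
    refine (abs_le_of_sq_le_sq' ?_ (by positivity)).2
    rw [mul_pow, sq_abs]
    nlinarith [norm_nonneg (n₁ - n₂)]
  refine false_of_crossing (α := inner ℝ n₁ n₂) (β := s * inner ℝ (quarterTurn n₁) n₂)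
    (p := inner ℝ y n₁) (q := s * inner ℝ y (quarterTurn n₁))
    (ξ₁ := s * inner ℝ x₁ (quarterTurn n₁)) (ξ₂ := s * inner ℝ x₂ (quarterTurn n₂))
    (ν₁ := inner ℝ x₁ n₁) (ν₂ := inner ℝ x₂ n₂) (ε := ε) ?_ hβn.2 h3 ?_ (by linarith) hξ₂
    hν₁ hν₂ (by linarith [hβn.1]) ?_ ?_ ?_
  · rw [inner_fin_two, inner_fin_two]
    simp only [quarterTurn_apply_zero, quarterTurn_apply_one]
    linear_combination (-n₁ 1 * n₂ 0 + n₁ 0 * n₂ 1) ^ 2 * hs - (n₂ 0 ^ 2 + n₂ 1 ^ 2) * e1 - e2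
  · rw [abs_mul, habs, one_mul]
    refine (abs_real_inner_le_norm _ _).trans ?_
    rw [norm_quarterTurn, hn₁, mul_one]
    exact hy
  · refine le_of_eq_of_le ?_ h1
    simp only [inner_fin_two, quarterTurn_apply_zero, quarterTurn_apply_one]
    linear_combination (-n₁ 1 * n₂ 0 + n₁ 0 * n₂ 1) * (-y 0 * n₁ 1 + y 1 * n₁ 0) * hs -
      (y 0 * n₂ 0 + y 1 * n₂ 1) * e1
  · refine le_of_eq_of_le ?_ h2
    simp only [inner_fin_two, quarterTurn_apply_zero, quarterTurn_apply_one, PiLp.add_apply]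
    linear_combination (-n₁ 1 * n₂ 0 + n₁ 0 * n₂ 1) *
      (-(y 0 + x₁ 0) * n₁ 1 + (y 1 + x₁ 1) * n₁ 0) * hs -
      ((y 0 + x₁ 0) * n₂ 0 + (y 1 + x₁ 1) * n₂ 1) * e1
  · refine le_of_eq_of_le ?_ h4
    simp only [inner_fin_two, quarterTurn_apply_zero, quarterTurn_apply_one, PiLp.sub_apply]
    linear_combination -(-n₁ 1 * n₂ 0 + n₁ 0 * n₂ 1) * (-x₂ 0 * n₂ 1 + x₂ 1 * n₂ 0) * hs -
      (x₂ 0 * n₁ 0 + x₂ 1 * n₁ 1) * e2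

end Plane

/-! ### Finiteness of the normals. -/

namespace SelfSimilarSubstitution

open TilingSpace

variable {M : Type*} {Φ : SelfSimilarSubstitution 2 M}

/-- The inner normals of boundary configurations form a finite set. -/
theorem finite_setOf_boundaryConfig (hprim : Φ.IsPrimitive) (hflc : HasFLC Φ.space)
    (hnonper : IsNonPeriodic Φ.space) :
    {n : EuclideanSpace ℝ (Fin 2) | ‖n‖ = 1 ∧ ∀ ε > 0, ∃ x S S',
      Φ.IsBoundaryConfig (Φ.scale + 5) ε n x S S'}.Finite := by
  obtain ⟨c₀, hc₀, hfree⟩ := exists_eq_zero_of_ball_subset_coincidenceSet hprim hflc hnonper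
  have hs := Φ.scale_pos
  -- The bounds serve, in order, the rigidity of y' - y, the overlap of the half-discs, and `‖n₁ -
  -- n₂‖ * ‖x₁‖ ≤ 1 / 8` for ‖x₁‖ ≤ λ.
  obtain ⟨δ, ⟨hδ1, hδ2, hδ3⟩, hδ⟩ : ∃ δ : ℝ, (δ ≤ c₀ / 2 ∧ δ ≤ 1 / 8 ∧ δ ≤ 1 / (8 * Φ.scale)) ∧
      0 < δ := ⟨min (c₀ / 2) (min (1 / 8) (1 / (8 * Φ.scale))),
    ⟨min_le_left _ _, (min_le_right _ _).trans (min_le_left _ _),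
      (min_le_right _ _).trans (min_le_right _ _)⟩, by positivity⟩
  obtain ⟨N, f, hN, hf⟩ := exists_finite_net (d := 2) (1 + Φ.scale) (half_pos hδ)
  obtain ⟨C, code, hC, hcode⟩ := exists_finite_patch_codes hflc
    (by positivity : 0 < Φ.scale + 5) hδ
  have hfdist : ∀ x x', ‖x‖ ≤ 1 + Φ.scale → ‖x'‖ ≤ 1 + Φ.scale → f x = f x' →
      ‖x - x'‖ < δ := by
    intro x x' hx hx' he
    have h1 := (hf x hx).2
    have h2 := (hf x' hx').2
    rw [← he] at h2
    have h3 := norm_sub_le (x - f x) (x' - f x)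
    rw [sub_sub_sub_cancel_right] at h3
    linarith
  by_contra hinf
  -- A single code works for all ε: if each of the finitely many codes failed at some threshold, an
  -- ε below all thresholds would leave no configuration, since configurations of smaller error are
  -- also ones of larger error.
  have hcodes : ∀ n ∈ {n : EuclideanSpace ℝ (Fin 2) | ‖n‖ = 1 ∧ ∀ ε > 0, ∃ x S S',
      Φ.IsBoundaryConfig (Φ.scale + 5) ε n x S S'}, ∃ c ∈ N ×ˢ C ×ˢ C, ∀ ε > 0, ∃ x S S',
      Φ.IsBoundaryConfig (Φ.scale + 5) ε n x S S' ∧ (f x, code S, code S') = c := by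
    rintro n ⟨-, hn⟩
    by_contra! hcon
    choose! e he hcon using hcon
    have h1 : ∀ᶠ ε in 𝓝[>] (0 : ℝ), ∀ c ∈ N ×ˢ C ×ˢ C, ε ≤ e c :=
      (eventually_all_finite (hN.prod (hC.prod hC))).2 fun c hc =>
        eventually_nhdsWithin_of_eventually_nhds (eventually_le_nhds (he c hc))
    obtain ⟨ε, hε, hε0⟩ := (h1.and self_mem_nhdsWithin).exists
    obtain ⟨x, S, S', h⟩ := hn ε hε0
    have hmem : (f x, code S, code S') ∈ N ×ˢ C ×ˢ C :=
      ⟨(hf x (by linarith [h.norm_le])).1, (hcode S h.left_mem).1, (hcode S' h.right_mem).1⟩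
    exact hcon _ hmem x S S' (h.mono (hε _ hmem)) rfl
  choose! c hc hcfg using hcodes
  have hmaps : MapsTo (fun n => (f n, c n)) {n : EuclideanSpace ℝ (Fin 2) | ‖n‖ = 1 ∧
      ∀ ε > 0, ∃ x S S', Φ.IsBoundaryConfig (Φ.scale + 5) ε n x S S'} (N ×ˢ (N ×ˢ C ×ˢ C)) :=
    fun n hn => ⟨(hf n (by linarith [hn.1])).1, hc n hn⟩
  obtain ⟨n₁, hn₁, n₂, hn₂, hne, heq⟩ := Set.Infinite.exists_ne_map_eq_of_mapsTo hinf hmaps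
    (hN.prod (hN.prod (hC.prod hC)))
  obtain ⟨heq1, heq2⟩ := Prod.mk.inj heq
  have hpos : 0 < ‖n₁ - n₂‖ := norm_pos_iff.2 (sub_ne_zero.2 hne)
  -- The error is fixed only after both normals are known, hence small against their distance.
  obtain ⟨x₁, S₁, S₁', h₁, hc₁⟩ := hcfg n₁ hn₁ (‖n₁ - n₂‖ / 32) (by positivity)
  obtain ⟨x₂, S₂, S₂', h₂, hc₂⟩ := hcfg n₂ hn₂ (‖n₁ - n₂‖ / 32) (by positivity)
  rw [← heq2, ← hc₁] at hc₂
  obtain ⟨hcx, hcS⟩ := Prod.mk.inj hc₂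
  obtain ⟨hcS, hcS'⟩ := Prod.mk.inj hcS
  obtain ⟨y, hy, hSy⟩ := (hcode S₁ h₁.left_mem).2 S₂ h₂.left_mem hcS
  obtain ⟨y', hy', hSy'⟩ := (hcode S₁' h₁.right_mem).2 S₂' h₂.right_mem hcS'
  have hx₁ := h₁.norm_le
  have hx₂ := h₂.norm_le
  have hn : ‖n₁ - n₂‖ < δ :=
    hfdist n₁ n₂ (by linarith [hn₁.1]) (by linarith [hn₂.1]) heq1
  have hx : ‖x₁ - x₂‖ < δ := hfdist x₁ x₂ (by linarith) (by linarith) hcx.symm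
  obtain ⟨i1, i2, i3, i4⟩ := h₁.inner_le hfree (by linarith) hδ2 le_rfl h₂ hn₁.1 hn₂.1 hn hy hy'
    hSy hSy'
  refine eq_of_crossing hn₁.1 hn₂.1 (by linarith) ?_ (by linarith) (by linarith)
    h₁.one_le_norm h₁.abs_inner_le h₂.abs_inner_le (by linarith) i1 i2 i3 i4
  calc ‖n₁ - n₂‖ * ‖x₁‖ ≤ 1 / (8 * Φ.scale) * Φ.scale :=
        mul_le_mul (by linarith) hx₁ (norm_nonneg _) (by positivity)
    _ = 1 / 8 := by field_simp

end SelfSimilarSubstitution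

/-! ### Components of ray directions and their frontiers. -/

section Circle

open Metric

/-- The determinant of two vectors of the plane. -/
def planeDet (x y : EuclideanSpace ℝ (Fin 2)) : ℝ := x 0 * y 1 - x 1 * y 0

theorem continuous_planeDet_right (x : EuclideanSpace ℝ (Fin 2)) : Continuous (planeDet x) := by
  unfold planeDet
  fun_prop

theorem continuous_planeDet_left (y : EuclideanSpace ℝ (Fin 2)) :
    Continuous (fun x => planeDet x y) := by
  unfold planeDet
  fun_prop

/-- For unit vectors, the squares of `planeDet` and of the inner product add up to 1. -/
theorem eq_or_eq_neg_of_planeDet_eq_zero {x y : EuclideanSpace ℝ (Fin 2)} (hx : ‖x‖ = 1)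
    (hy : ‖y‖ = 1) (h : planeDet x y = 0) : y = x ∨ y = -x := by
  have ex := norm_sq_fin_two x
  have ey := norm_sq_fin_two y
  rw [hx, one_pow] at ex
  rw [hy, one_pow] at ey
  unfold planeDet at h
  have h1 : (x 0 * y 0 + x 1 * y 1 - 1) * (x 0 * y 0 + x 1 * y 1 + 1) = 0 := by
    linear_combination -(x 0 * y 1 - x 1 * y 0) * h - (y 0 ^ 2 + y 1 ^ 2) * ex - ey
  rcases mul_eq_zero.1 h1 with h2 | h2
  · left
    ext i
    fin_cases i
    · simp only [Fin.zero_eta]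
      linear_combination y 0 * ex + x 0 * h2 - x 1 * h
    · simp only [Fin.mk_one]
      linear_combination y 1 * ex + x 1 * h2 + x 0 * h
  · right
    ext i
    fin_cases i
    · simp only [Fin.zero_eta, PiLp.neg_apply]
      linear_combination y 0 * ex + x 0 * h2 - x 1 * h
    · simp only [Fin.mk_one, PiLp.neg_apply]
      linear_combination y 1 * ex + x 1 * h2 + x 0 * h

/-- Spherical caps are connected. -/
theorem isPreconnected_cap {E : Type*} [NormedAddCommGroup E] [InnerProductSpace ℝ E] (a : E)
    {c : ℝ} (hc : 0 ≤ c) : IsPreconnected {v : E | ‖v‖ = 1 ∧ c < inner ℝ v a} := by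
  -- The cap is the radial projection of this cone, which is convex as c ≥ 0 and omits 0 by
  -- strictness.
  have hconv : Convex ℝ {w : E | c * ‖w‖ < inner ℝ w a} := by
    rw [convex_iff_forall_pos]
    intro x hx y hy s t hs ht hst
    simp only [mem_ofPred_eq] at hx hy ⊢
    rw [inner_add_left, real_inner_smul_left, real_inner_smul_left]
    have h1 : ‖s • x + t • y‖ ≤ s * ‖x‖ + t * ‖y‖ := by
      refine (norm_add_le _ _).trans_eq ?_
      rw [norm_smul, norm_smul, Real.norm_of_nonneg hs.le, Real.norm_of_nonneg ht.le]
    have h2 := mul_le_mul_of_nonneg_left h1 hc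
    have h3 := mul_lt_mul_of_pos_left hx hs
    have h4 := mul_lt_mul_of_pos_left hy ht
    linarith
  have hne : ∀ w ∈ {w : E | c * ‖w‖ < inner ℝ w a}, ‖w‖ ≠ 0 := by
    intro w hw h0
    have : w = 0 := norm_eq_zero.1 h0
    simp [this] at hw
  have himg : {v : E | ‖v‖ = 1 ∧ c < inner ℝ v a} =
      (fun w => ‖w‖⁻¹ • w) '' {w : E | c * ‖w‖ < inner ℝ w a} := by
    ext v
    constructor
    · rintro ⟨h1, h2⟩
      exact ⟨v, by simpa [h1] using h2, by simp [h1]⟩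
    · rintro ⟨w, hw, rfl⟩
      have h0 := hne w hw
      have hpos : 0 < ‖w‖ := lt_of_le_of_ne (norm_nonneg w) h0.symm
      refine ⟨?_, ?_⟩
      · simp only [norm_smul, norm_inv, norm_norm]
        exact inv_mul_cancel₀ h0
      · simp only [real_inner_smul_left]
        rw [← div_eq_inv_mul, lt_div_iff₀ hpos]
        exact hw
  rw [himg]
  exact hconv.isPreconnected.image _
    ((continuousOn_id.norm.inv₀ hne).smul continuousOn_id)

variable {A : Set (EuclideanSpace ℝ (Fin 2))} {u a : EuclideanSpace ℝ (Fin 2)}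

/-- The unit vectors that span an open ray contained in `A`. -/
def rayDirections (A : Set (EuclideanSpace ℝ (Fin 2))) : Set (EuclideanSpace ℝ (Fin 2)) :=
  {v | ‖v‖ = 1 ∧ ∀ t : ℝ, 0 < t → t • v ∈ A}

theorem hemisphere_subset_connectedComponentIn (hu : ‖u‖ = 1)
    (hA : ∀ z : EuclideanSpace ℝ (Fin 2), 0 < inner ℝ z u → z ∈ A) :
    {v : EuclideanSpace ℝ (Fin 2) | ‖v‖ = 1 ∧ 0 < inner ℝ v u} ⊆
      connectedComponentIn (rayDirections A) u := by
  refine (isPreconnected_cap u le_rfl).subset_connectedComponentIn ⟨hu, ?_⟩ ?_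
  · rw [real_inner_self_eq_norm_sq, hu]
    norm_num
  · rintro v ⟨hv, hvu⟩
    refine ⟨hv, fun t ht => hA _ ?_⟩
    rw [real_inner_smul_left]
    positivity

/-- Near a relative frontier point of a component of ray directions there are unit vectors that are
not ray directions. -/
theorem exists_notMem_rayDirections (ha : ‖a‖ = 1)
    (h1 : a ∈ closure (connectedComponentIn (rayDirections A) u))
    (h2 : a ∈ closure (sphere 0 1 \ connectedComponentIn (rayDirections A) u))
    {ε : ℝ} (hε : 0 < ε) : ∃ b, ‖b‖ = 1 ∧ ‖b - a‖ < ε ∧ b ∉ rayDirections A := by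
  -- Since ‖v - a‖² = 2 - 2⟪v, a⟫ for unit vectors, ⟪v, a⟫ > c gives ‖v - a‖ < ε; the maximum with 0
  -- allows `isPreconnected_cap`.
  set c : ℝ := max 0 (1 - ε ^ 2 / 2) with hc
  have hc1 : c < 1 := max_lt one_pos (by linarith [pow_pos hε 2])
  have hcap : ∀ v : EuclideanSpace ℝ (Fin 2), ‖v‖ = 1 → c < inner ℝ v a → ‖v - a‖ < ε := by
    intro v hv hva
    refine lt_of_pow_lt_pow_left₀ 2 hε.le ?_
    rw [norm_sub_sq_real, hv, ha]
    have := (le_max_right 0 (1 - ε ^ 2 / 2)).trans_lt hva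
    linarith
  by_contra! hcon
  have hopen : IsOpen {v : EuclideanSpace ℝ (Fin 2) | c < inner ℝ v a} :=
    isOpen_lt continuous_const (by fun_prop)
  have haO : a ∈ {v : EuclideanSpace ℝ (Fin 2) | c < inner ℝ v a} := by
    simp only [mem_ofPred_eq]
    rw [real_inner_self_eq_norm_sq, ha]
    simpa using hc1
  obtain ⟨s, hsO, hs⟩ := mem_closure_iff.1 h1 _ hopen haO
  obtain ⟨b, hbO, hb, hbS⟩ := mem_closure_iff.1 h2 _ hopen haO
  have hsD := connectedComponentIn_subset _ _ hs
  -- A connected cap of ray directions that meets the component is absorbed by it.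
  have h3 := (isPreconnected_cap a (le_max_left 0 (1 - ε ^ 2 / 2))).subset_connectedComponentIn
    (x := s) (F := rayDirections A) ⟨hsD.1, hsO⟩ (fun v hv => hcon v hv.1 (hcap v hv.1 hv.2))
  rw [← connectedComponentIn_eq hs] at h3
  exact hbS (h3 ⟨by simpa using hb, hbO⟩)

/-- The line through a relative frontier point of the component of ray directions that contains a
hemisphere bounds an open half-plane contained in `A`. -/
theorem exists_halfPlane_subset (hu : ‖u‖ = 1)
    (hA : ∀ z : EuclideanSpace ℝ (Fin 2), 0 < inner ℝ z u → z ∈ A) (ha : ‖a‖ = 1)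
    (h1 : a ∈ closure (connectedComponentIn (rayDirections A) u))
    (h2 : a ∈ closure (sphere 0 1 \ connectedComponentIn (rayDirections A) u)) :
    ∃ n, (n = quarterTurn a ∨ n = -quarterTurn a) ∧
      ∀ z : EuclideanSpace ℝ (Fin 2), 0 < inner ℝ z n → z ∈ A := by
  have hau : inner ℝ a u ≤ 0 := by
    by_contra! h
    obtain ⟨z, hz, hzs, hzS⟩ := mem_closure_iff.1 h2
      {z : EuclideanSpace ℝ (Fin 2) | 0 < inner ℝ z u}
      (isOpen_lt continuous_const (by fun_prop)) h
    exact hzS (hemisphere_subset_connectedComponentIn hu hA ⟨by simpa using hzs, hz⟩)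
  rcases hau.eq_or_lt with hau | hau
  · refine ⟨u, eq_or_eq_neg_of_planeDet_eq_zero (by rw [norm_quarterTurn, ha]) hu ?_, hA⟩
    rw [inner_fin_two] at hau
    simp only [planeDet, quarterTurn_apply_zero, quarterTurn_apply_one]
    linarith
  by_contra! hcon
  -- unit vectors on both sides of the line spanned by `a` that are not ray directions
  have hdir : ∀ n z : EuclideanSpace ℝ (Fin 2), 0 < inner ℝ z n → z ∉ A →
      ∃ p, ‖p‖ = 1 ∧ 0 < inner ℝ p n ∧ inner ℝ p u ≤ 0 ∧ p ∉ rayDirections A := by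
    intro n z hz hzA
    have hz0 : 0 < ‖z‖ := by
      rw [norm_pos_iff]
      rintro rfl
      simp at hz
    refine ⟨‖z‖⁻¹ • z, by rw [norm_smul, norm_inv, norm_norm, inv_mul_cancel₀ hz0.ne'], ?_, ?_, fun hp => hzA ?_⟩
    · rw [real_inner_smul_left]
      positivity
    · rw [real_inner_smul_left]
      refine mul_nonpos_of_nonneg_of_nonpos (by positivity) ?_
      by_contra! h
      exact hzA (hA z h)
    · have := hp.2 ‖z‖ hz0
      rwa [smul_inv_smul₀ hz0.ne'] at this
  obtain ⟨z, hz, hzA⟩ := hcon _ (Or.inl rfl)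
  obtain ⟨z', hz', hzA'⟩ := hcon _ (Or.inr rfl)
  obtain ⟨p, hp, hpa, hpu, hpD⟩ := hdir _ z hz hzA
  obtain ⟨q, hq, hqa, hqu, hqD⟩ := hdir _ z' hz' hzA'
  have hP : 0 < planeDet a p := by
    rw [inner_fin_two] at hpa
    simp only [planeDet, quarterTurn_apply_zero, quarterTurn_apply_one] at hpa ⊢
    linarith
  have hQ : 0 < planeDet q a := by
    rw [inner_neg_right, inner_fin_two] at hqa
    simp only [planeDet, quarterTurn_apply_zero, quarterTurn_apply_one] at hqa ⊢
    linarith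
  have hpq : p ≠ q := by
    rintro rfl
    unfold planeDet at hP hQ
    linarith
  -- The arc from q through a to p is at most a half circle, because p, q and a all lie in ⟪·, u⟫ ≤
  -- 0.
  have hD : 0 ≤ planeDet q p := by
    have e1 : planeDet q p * inner ℝ a u =
        planeDet q a * inner ℝ p u + planeDet a p * inner ℝ q u := by
      simp only [inner_fin_two, planeDet]
      ring
    have e2 := mul_nonpos_of_nonneg_of_nonpos hQ.le hpu
    have e3 := mul_nonpos_of_nonneg_of_nonpos hP.le hqu
    by_contra! h
    have := mul_pos_of_neg_of_neg h hau
    linarith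
  have hopp : planeDet q p ≤ 0 → p = -q := fun h =>
    (eq_or_eq_neg_of_planeDet_eq_zero hq hp (le_antisymm h hD)).resolve_left hpq
  have hS : IsPreconnected (connectedComponentIn (rayDirections A) u) :=
    isPreconnected_connectedComponentIn
  -- The first set is the open sector from q to p, which contains a; the second is the outside of
  -- the closed sector, which contains u. The component avoids p and q, accumulates at a and
  -- contains u, so they would disconnect it.
  have hU : IsOpen {z | 0 < planeDet q z ∧ 0 < planeDet z p} :=
    (isOpen_lt continuous_const (continuous_planeDet_right q)).inter
      (isOpen_lt continuous_const (continuous_planeDet_left p))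
  have hV : IsOpen {z | planeDet q z < 0 ∨ planeDet z p < 0} :=
    (isOpen_lt (continuous_planeDet_right q) continuous_const).union
      (isOpen_lt (continuous_planeDet_left p) continuous_const)
  refine absurd (hS _ _ hU hV ?_ ?_ ?_) ?_
  · intro w hw
    have hwD := connectedComponentIn_subset _ _ hw
    have hwp : w ≠ p := fun h => hpD (h ▸ hwD)
    have hwq : w ≠ q := fun h => hqD (h ▸ hwD)
    by_contra hnot
    simp only [mem_union, mem_ofPred_eq, not_or, not_and, not_lt] at hnot
    obtain ⟨hn1, hn2, hn3⟩ := hnot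
    rcases hn2.eq_or_lt with h0 | h0
    · have hwn := (eq_or_eq_neg_of_planeDet_eq_zero hq hwD.1 h0.symm).resolve_left hwq
      refine hwp (hwn.trans (hopp ?_).symm)
      rw [hwn] at hn3
      simp only [planeDet, PiLp.neg_apply] at hn3 ⊢
      linarith
    · have h0' := le_antisymm (hn1 h0) hn3
      have hwn := (eq_or_eq_neg_of_planeDet_eq_zero (x := p) hp hwD.1 (by
        unfold planeDet at h0' ⊢
        linarith)).resolve_left hwp
      refine hwq (hwn.trans ?_)
      rw [hopp ?_, neg_neg]
      rw [hwn] at hn2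
      simp only [planeDet, PiLp.neg_apply] at hn2 ⊢
      linarith
  · obtain ⟨s, hsU, hs⟩ := mem_closure_iff.1 h1 _ hU ⟨hQ, hP⟩
    exact ⟨s, hs, hsU⟩
  · refine ⟨u, hemisphere_subset_connectedComponentIn hu hA ⟨hu, ?_⟩, ?_⟩
    · rw [real_inner_self_eq_norm_sq, hu]
      norm_num
    · by_contra hnot
      simp only [mem_ofPred_eq, not_or, not_lt] at hnot
      obtain ⟨hn1, hn2⟩ := hnot
      have eu := norm_sq_fin_two u
      rw [hu, one_pow] at eu
      have e1 : planeDet q a = inner ℝ a u * planeDet q u + planeDet u a * inner ℝ q u := by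
        simp only [inner_fin_two, planeDet]
        linear_combination (q 0 * a 1 - q 1 * a 0) * eu
      have e2 : planeDet a p = inner ℝ a u * planeDet u p - planeDet u a * inner ℝ p u := by
        simp only [inner_fin_two, planeDet]
        linear_combination (a 0 * p 1 - a 1 * p 0) * eu
      have e3 := mul_nonpos_of_nonpos_of_nonneg hau.le hn1
      have e4 := mul_nonpos_of_nonpos_of_nonneg hau.le hn2
      rcases le_total 0 (planeDet u a) with h | h
      · have := mul_nonpos_of_nonneg_of_nonpos h hqu
        linarith
      · have := mul_nonneg_of_nonpos_of_nonpos h hpu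
        linarith
  · rintro ⟨w, -, ⟨hw1, hw2⟩, hw | hw⟩
    · exact lt_asymm hw hw1
    · exact lt_asymm hw hw2

/-- There are only finitely many subsets of the circle whose relative frontier is contained in a
given finite set. -/
theorem finite_setOf_frontier_subset {E : Set (EuclideanSpace ℝ (Fin 2))} (hE : E.Finite) :
    {S : Set (EuclideanSpace ℝ (Fin 2)) | S ⊆ sphere 0 1 ∧
      ∀ a, ‖a‖ = 1 → a ∈ closure S → a ∈ closure (sphere 0 1 \ S) → a ∈ E}.Finite := by
  -- Adding e₁ makes F nonempty, which keeps segments between points of equal sign pattern away from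
  -- the origin.
  set e₁ : EuclideanSpace ℝ (Fin 2) := EuclideanSpace.single 0 1
  set F : Set (EuclideanSpace ℝ (Fin 2)) := insert e₁ (E ∩ sphere 0 1) with hF
  have hFfin : F.Finite := (hE.inter_of_left _).insert e₁
  have hFs : ∀ a ∈ F, ‖a‖ = 1 := by
    rintro a (rfl | ha)
    · simp [e₁]
    · simpa using ha.2
  set F' : Set (EuclideanSpace ℝ (Fin 2)) := F ∪ (fun a => -a) '' F with hF'
  have hF'fin : F'.Finite := hFfin.union (hFfin.image _)
  have hdet : ∀ a ∈ F, ∀ z, ‖z‖ = 1 → z ∉ F' → planeDet a z ≠ 0 := by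
    intro a ha z hz hzF h
    rcases eq_or_eq_neg_of_planeDet_eq_zero (hFs a ha) hz h with rfl | rfl
    · exact hzF (Or.inl ha)
    · exact hzF (Or.inr ⟨a, ha, rfl⟩)
  -- Sign patterns label the open arcs cut out by the lines spanned by F. A set with frontier in E
  -- contains or misses each arc, so the arcs it meets and its trace on F' determine it.
  set sgn : EuclideanSpace ℝ (Fin 2) → Set (EuclideanSpace ℝ (Fin 2)) :=
    fun z => {a ∈ F | 0 < planeDet a z} with hsgn
  refine Set.Finite.of_injOn (f := fun S => (S ∩ F', sgn '' (S \ F')))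
    (t := 𝒫 F' ×ˢ 𝒫 (𝒫 F)) ?_ ?_ (hF'fin.finite_subsets.prod hFfin.finite_subsets.finite_subsets)
  · rintro S -
    refine ⟨inter_subset_right, ?_⟩
    rintro _ ⟨z, -, rfl⟩
    exact sep_subset _ _
  have key : ∀ S₁ S₂ : Set (EuclideanSpace ℝ (Fin 2)), S₁ ⊆ sphere 0 1 → S₂ ⊆ sphere 0 1 →
      (∀ a, ‖a‖ = 1 → a ∈ closure S₂ → a ∈ closure (sphere 0 1 \ S₂) → a ∈ E) →
      S₁ ∩ F' = S₂ ∩ F' → sgn '' (S₁ \ F') = sgn '' (S₂ \ F') → S₁ ⊆ S₂ := by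
    intro S₁ S₂ hS₁ hS₂ hfr heq₁ heq₂ z hz
    by_cases hzF : z ∈ F'
    · have : z ∈ S₁ ∩ F' := ⟨hz, hzF⟩
      rw [heq₁] at this
      exact this.1
    have hz1 : ‖z‖ = 1 := by simpa using hS₁ hz
    have h1 : sgn z ∈ sgn '' (S₂ \ F') := heq₂ ▸ mem_image_of_mem sgn ⟨hz, hzF⟩
    obtain ⟨w, ⟨hw, hwF⟩, hwz⟩ := h1
    have hw1 : ‖w‖ = 1 := by simpa using hS₂ hw
    have hseg : ∀ x ∈ segment ℝ w z, ∀ a ∈ F, planeDet a x ≠ 0 := by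
      rintro x ⟨s, t, hs, ht, hst, rfl⟩ a ha
      have e1 : planeDet a (s • w + t • z) = s * planeDet a w + t * planeDet a z := by
        simp only [planeDet, PiLp.add_apply, PiLp.smul_apply, smul_eq_mul]
        ring
      rw [e1]
      have e2 : 0 < planeDet a w ↔ 0 < planeDet a z := by
        have : a ∈ sgn w ↔ a ∈ sgn z := by rw [hwz]
        simpa [hsgn, ha] using this
      have e3 := hdet a ha w hw1 hwF
      have e4 := hdet a ha z hz1 hzF
      have hcases : (0 < s ∧ 0 ≤ t) ∨ (0 ≤ s ∧ 0 < t) := by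
        rcases hs.eq_or_lt with h | h
        · right
          exact ⟨hs, by linarith⟩
        · exact Or.inl ⟨h, ht⟩
      rcases lt_or_gt_of_ne e3 with h | h
      · have h' : planeDet a z < 0 := lt_of_le_of_ne (not_lt.1 fun h5 => lt_asymm h (e2.2 h5)) e4
        have : s * planeDet a w + t * planeDet a z < 0 := by
          rcases hcases with ⟨h6, h7⟩ | ⟨h6, h7⟩ <;> nlinarith
        exact this.ne
      · have h' := e2.1 h
        have : 0 < s * planeDet a w + t * planeDet a z := by
          rcases hcases with ⟨h6, h7⟩ | ⟨h6, h7⟩ <;> positivity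
        exact this.ne'
    have hne : ∀ x ∈ segment ℝ w z, ‖x‖ ≠ 0 := by
      intro x hx h0
      refine hseg x hx e₁ (mem_insert _ _) ?_
      rw [norm_eq_zero.1 h0]
      simp [planeDet]
    have hpath : IsPreconnected ((fun x => ‖x‖⁻¹ • x) '' segment ℝ w z) :=
      (convex_segment w z).isPreconnected.image _
        ((continuousOn_id.norm.inv₀ hne).smul continuousOn_id)
    have hnorm : ∀ x ∈ segment ℝ w z, ‖‖x‖⁻¹ • x‖ = 1 := fun x hx => by
      rw [norm_smul, norm_inv, norm_norm]
      exact inv_mul_cancel₀ (hne x hx)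
    by_contra hzS
    -- The projected segment runs from a point of S₂ to a point outside it without meeting the
    -- frontier, so the two exteriors would disconnect it.
    refine absurd (hpath (closure S₂)ᶜ (closure (sphere 0 1 \ S₂))ᶜ
      isClosed_closure.isOpen_compl isClosed_closure.isOpen_compl ?_ ?_ ?_) ?_
    · rintro _ ⟨x, hx, rfl⟩
      by_contra hnot
      simp only [mem_union, mem_compl_iff, not_or, not_not] at hnot
      have hxE := hfr _ (hnorm x hx) hnot.1 hnot.2
      refine hseg x hx _ (mem_insert_of_mem _ ⟨hxE, by simpa using hnorm x hx⟩) ?_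
      simp only [planeDet, PiLp.smul_apply, smul_eq_mul]
      ring
    · refine ⟨z, ⟨z, right_mem_segment ℝ w z, by simp [hz1]⟩, fun hzc => ?_⟩
      have hzE := hfr z hz1 hzc (subset_closure ⟨by simpa using hz1, hzS⟩)
      exact hzF (Or.inl (mem_insert_of_mem _ ⟨hzE, by simpa using hz1⟩))
    · refine ⟨w, ⟨w, left_mem_segment ℝ w z, by simp [hw1]⟩, fun hwc => ?_⟩
      have hwE := hfr w hw1 (subset_closure hw) hwc
      exact hwF (Or.inl (mem_insert_of_mem _ ⟨hwE, by simpa using hw1⟩))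
    · rintro ⟨_, ⟨x, hx, rfl⟩, hx1, hx2⟩
      by_cases hxS : ‖x‖⁻¹ • x ∈ S₂
      · exact hx1 (subset_closure hxS)
      · exact hx2 (subset_closure ⟨by simpa using hnorm x hx, hxS⟩)
  rintro S₁ ⟨h₁, hf₁⟩ S₂ ⟨h₂, hf₂⟩ heq
  obtain ⟨heq1, heq2⟩ := Prod.mk.inj heq
  exact (key S₁ S₂ h₁ h₂ hf₂ heq1 heq2).antisymm (key S₂ S₁ h₂ h₁ hf₁ heq1.symm heq2.symm)

end Circle

/-! ### From sectors to boundary configurations, and the conclusion. -/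

namespace SelfSimilarSubstitution

open TilingSpace

variable {M : Type*} {Φ : SelfSimilarSubstitution 2 M}

/-- Rescaling a point outside of the coincidence set to norm about `1`. -/
theorem exists_isBoundaryConfig (hprim : Φ.IsPrimitive) {T T' : Set (Tile 2 M)}
    (hT : T ∈ Φ.space) (hT' : T' ∈ Φ.space) {n x : EuclideanSpace ℝ (Fin 2)} {ε : ℝ}
    (hn : ∀ z : EuclideanSpace ℝ (Fin 2), 0 < inner ℝ z n → z ∈ Φ.coincidenceSet T T')
    (h0 : 0 ∉ Φ.coincidenceSet T T') (hx : x ∉ Φ.coincidenceSet T T') (hx0 : x ≠ 0)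
    (hxn : |inner ℝ x n| ≤ ε * ‖x‖) :
    ∃ x S S', Φ.IsBoundaryConfig (Φ.scale + 5) (ε * Φ.scale) n x S S' := by
  have hs := Φ.scale_pos
  have hpos : 0 < ‖x‖ := norm_pos_iff.2 hx0
  have hε : 0 ≤ ε := by
    by_contra! h
    have := mul_neg_of_neg_of_pos h hpos
    linarith [abs_nonneg (inner ℝ x n : ℝ)]
  have hinner : ∀ c : ℝ, 0 < c → c * ‖x‖ ≤ Φ.scale → |inner ℝ (c • x) n| ≤ ε * Φ.scale := by
    intro c hc hcx
    rw [real_inner_smul_left, abs_mul, abs_of_pos hc]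
    calc c * |inner ℝ x n| ≤ c * (ε * ‖x‖) := mul_le_mul_of_nonneg_left hxn hc.le
      _ = ε * (c * ‖x‖) := by ring
      _ ≤ ε * Φ.scale := mul_le_mul_of_nonneg_left hcx hε
  have hnorm : ∀ c : ℝ, 0 < c → ‖c • x‖ = c * ‖x‖ := fun c hc => by
    rw [norm_smul, Real.norm_of_nonneg hc.le]
  -- Far points are desubstituted m times, where λ^m ≤ ‖x‖ < λ^(m+1). Near points are substituted m
  -- + 1 times, where λ^m ≤ ‖x‖⁻¹ < λ^(m+1); the extra step brings the norm up to at least 1.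
  rcases le_or_gt 1 ‖x‖ with h1 | h1
  · obtain ⟨m, hm1, hm2⟩ := exists_nat_pow_near h1 Φ.one_lt_scale
    have hm := Φ.scale_pow_pos m
    have hc : 0 < (Φ.scale ^ m)⁻¹ := inv_pos.2 hm
    have hcx : (Φ.scale ^ m)⁻¹ * ‖x‖ ≤ Φ.scale := by
      rw [inv_mul_le_iff₀ hm, ← pow_succ]
      exact hm2.le
    obtain ⟨S, hS, hST⟩ := exists_iterate_subst_star_eq hprim hT m (Φ.scale + 5)
    obtain ⟨S', hS', hST'⟩ := exists_iterate_subst_star_eq hprim hT' m (Φ.scale + 5)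
    have key : ∀ z : EuclideanSpace ℝ (Fin 2), ‖z‖ < Φ.scale + 5 →
        (z ∈ Φ.coincidenceSet S S' ↔ Φ.scale ^ m • z ∈ Φ.coincidenceSet T T') := by
      intro z hz
      rw [← smul_mem_coincidenceSet_iterate (hasProtoTiles_of_mem_space hS)
        (hasProtoTiles_of_mem_space hS') (m := m)]
      exact mem_coincidenceSet_congr
        (hasProtoTiles_of_mem_space (iterate_subst_mem_space hS m))
        (hasProtoTiles_of_mem_space (iterate_subst_mem_space hS' m))
        (hasProtoTiles_of_mem_space hT) (hasProtoTiles_of_mem_space hT') (hST z hz) (hST' z hz)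
    refine ⟨(Φ.scale ^ m)⁻¹ • x, S, S', hS, hS', ?_, ?_, hinner _ hc hcx, ?_, ?_, ?_⟩
    · rw [hnorm _ hc, le_inv_mul_iff₀ hm, mul_one]
      exact hm1
    · rwa [hnorm _ hc]
    · rw [key 0 (by simp; linarith), smul_zero]
      exact h0
    · rwa [key _ (by rw [hnorm _ hc]; linarith), smul_inv_smul₀ hm.ne']
    · intro z hz hzn
      rw [key z hz]
      refine hn _ ?_
      rw [real_inner_smul_left]
      positivity
  · obtain ⟨m, hm1, hm2⟩ := exists_nat_pow_near (one_le_inv_iff₀.2 ⟨hpos, h1.le⟩)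
      Φ.one_lt_scale
    have hm := Φ.scale_pow_pos (m + 1)
    have hcx : Φ.scale ^ (m + 1) * ‖x‖ ≤ Φ.scale := by
      have h2 : Φ.scale ^ m * ‖x‖ ≤ 1 := by
        rwa [← le_inv_mul_iff₀' hpos, mul_one]
      calc Φ.scale ^ (m + 1) * ‖x‖ = Φ.scale * (Φ.scale ^ m * ‖x‖) := by ring
        _ ≤ Φ.scale * 1 := mul_le_mul_of_nonneg_left h2 hs.le
        _ = Φ.scale := mul_one _
    have key : ∀ z : EuclideanSpace ℝ (Fin 2), Φ.scale ^ (m + 1) • z ∈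
        Φ.coincidenceSet (Φ.subst^[m + 1] T) (Φ.subst^[m + 1] T') ↔
        z ∈ Φ.coincidenceSet T T' := fun z =>
      smul_mem_coincidenceSet_iterate (hasProtoTiles_of_mem_space hT)
        (hasProtoTiles_of_mem_space hT')
    refine ⟨Φ.scale ^ (m + 1) • x, _, _, iterate_subst_mem_space hT (m + 1),
      iterate_subst_mem_space hT' (m + 1), ?_, ?_, hinner _ hm hcx, ?_, ?_, ?_⟩
    · rw [hnorm _ hm]
      rw [inv_lt_iff_one_lt_mul₀ hpos] at hm2
      exact hm2.le
    · rwa [hnorm _ hm]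
    · rwa [← key, smul_zero] at h0
    · rwa [key]
    · intro z hz hzn
      rw [← smul_inv_smul₀ hm.ne' z, key]
      refine hn _ ?_
      rw [real_inner_smul_left]
      have := inv_pos.2 hm
      positivity

theorem stableDirections_eq_rayDirections {T T' : Set (Tile 2 M)} (hT : T ∈ Φ.space)
    (hT' : T' ∈ Φ.space) :
    Φ.stableDirections T T' = rayDirections (Φ.coincidenceSet T T') := by
  ext v
  simp only [stableDirections, rayDirections, mem_ofPred_eq, stablyEquiv_translate_iff hT hT',
    mem_sphere_iff_norm, sub_zero]

end SelfSimilarSubstitution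

open SelfSimilarSubstitution TilingSpace in
theorem mainTheorem2 {M : Type*} (Φ : SelfSimilarSubstitution 2 M)
    (hpoly : Φ.HasConvexPolygonalTiles) (hprim : Φ.IsPrimitive)
    (hflc : TilingSpace.HasFLC Φ.space) (hnonper : TilingSpace.IsNonPeriodic Φ.space) :
    {S : Set (EuclideanSpace ℝ (Fin 2)) |
      ∃ T T' : Set (Tile 2 M), Φ.IsBranchPair T T' ∧ Φ.IsAsymptoticSector T T' S}.Finite := by
  have hG := finite_setOf_boundaryConfig hprim hflc hnonper
  set G := {n : EuclideanSpace ℝ (Fin 2) | ‖n‖ = 1 ∧ ∀ ε > 0, ∃ x S S',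
      Φ.IsBoundaryConfig (Φ.scale + 5) ε n x S S'} with hGdef
  have hs := Φ.scale_pos
  -- A normal determines its frontier direction up to sign, hence both quarter turns.
  have hE : (quarterTurn '' G ∪ (fun n => -quarterTurn n) '' G).Finite :=
    (hG.image _).union (hG.image _)
  refine (finite_setOf_frontier_subset hE).subset ?_
  rintro S ⟨T, T', ⟨hT, hT', hne, -⟩, u, hu, hhalf, rfl⟩
  have hA : ∀ z : EuclideanSpace ℝ (Fin 2), 0 < inner ℝ z u → z ∈ Φ.coincidenceSet T T' :=
    fun z hz => (stablyEquiv_translate_iff hT hT').1 (hhalf z hz)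
  have h0 : 0 ∉ Φ.coincidenceSet T T' :=
    fun h => hne (stablyEquiv_of_zero_mem_coincidenceSet hT hT' h)
  rw [stableDirections_eq_rayDirections hT hT']
  refine ⟨fun v hv => by simpa using (connectedComponentIn_subset _ _ hv).1,
    fun a ha h1 h2 => ?_⟩
  obtain ⟨n, hna, hnA⟩ := exists_halfPlane_subset hu hA ha h1 h2
  have hn1 : ‖n‖ = 1 := by
    rcases hna with rfl | rfl
    · rw [norm_quarterTurn, ha]
    · rw [norm_neg, norm_quarterTurn, ha]
  have han : inner ℝ a n = 0 := by
    rcases hna with rfl | rfl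
    · rw [inner_fin_two, quarterTurn_apply_zero, quarterTurn_apply_one]
      ring
    · rw [inner_neg_right, inner_fin_two, quarterTurn_apply_zero, quarterTurn_apply_one]
      ring
  have hnG : n ∈ G := by
    refine ⟨hn1, fun ε hε => ?_⟩
    -- Rescaling costs a factor of at most λ in the error, hence ε / λ; since a ⟂ n, the normal part
    -- of b is at most ‖b - a‖.
    obtain ⟨b, hb1, hba, hbD⟩ := exists_notMem_rayDirections ha h1 h2 (div_pos hε hs)
    obtain ⟨t, ht, htb⟩ : ∃ t : ℝ, 0 < t ∧ t • b ∉ Φ.coincidenceSet T T' := by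
      by_contra! h
      exact hbD ⟨hb1, h⟩
    have hb0 : b ≠ 0 := by
      rintro rfl
      simp at hb1
    have := exists_isBoundaryConfig (ε := ε / Φ.scale) hprim hT hT' hnA h0 htb
      (smul_ne_zero ht.ne' hb0) ?_
    · rwa [div_mul_cancel₀ _ hs.ne'] at this
    · rw [real_inner_smul_left, abs_mul, abs_of_pos ht, norm_smul, hb1,
        Real.norm_of_nonneg ht.le, mul_one, mul_comm]
      refine mul_le_mul_of_nonneg_right ?_ ht.le
      have h3 : inner ℝ b n = inner ℝ (b - a) n := by
        rw [inner_sub_left, han, sub_zero]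
      rw [h3]
      refine (abs_real_inner_le_norm _ _).trans ?_
      rw [hn1, mul_one]
      exact hba.le
  have hqq : ∀ z : EuclideanSpace ℝ (Fin 2), quarterTurn (quarterTurn z) = -z := by
    intro z
    ext i
    fin_cases i <;> simp
  have hqn : quarterTurn (-quarterTurn a) = a := by
    ext i
    fin_cases i <;> simp
  rcases hna with rfl | rfl
  · exact Or.inr ⟨_, hnG, by simp [hqq]⟩
  · exact Or.inl ⟨_, hnG, hqn⟩
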